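/- A tree is called linear if all of its vertices of degree at least $3$ lie on a single induced path. Let $a_n$ be the number of non-isomorphic linear trees on $n$ vertices, let $t_n$ be the number of non-isomorphic trees on $n$ vertices, and for $0<x<1$ let $P(x)=\prod_{i=1}^\infty \frac{1}{1-x^i}$; this product converges, and $P$ is differentiable on $(0,1)$. The equation $xP(x)=1$ has a unique solution $x_0$ in $(0,1)$, with $x_0=0.4196\ldots$, and, as $n\to\infty$, $$a_n \sim C\,\Bigl(\frac1{x_0}\Bigr)^{n},\qquad C=\frac12\Bigl(P(x_0)-\frac1{1-x_0}\Bigr)^2\frac{x_0}{P(x_0)+x_0P'(x_0)},$$ where, numerically, $C\approx 0.01450$ (with error at most $5\cdot10^{-6}$) and $1/x_0\approx 2.3832$ (with error at most $5\cdot10^{-5}$), so that $C\,(1/x_0)^n\approx 0.01450\cdot 2.3832^n$. In particular, linear trees form a vanishing proportion of all trees: $a_n/t_n\to 0$ as $n\to\infty$. -/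

import Mathlib

open Filter Topology Asymptotics

namespace LinearTrees

/-- A high degree vertex (HDV): a vertex with at least three neighbours. -/
def IsHDV {V : Type*} (G : SimpleGraph V) (v : V) : Prop :=
  3 ≤ (G.neighborSet v).encard

/-- A linear tree: a tree all of whose high degree vertices lie on a single induced path. -/
def IsLinearTree {V : Type*} (G : SimpleGraph V) : Prop :=
  G.IsTree ∧ ∃ (u v : V) (p : G.Walk u v),
    p.IsPath ∧ p.toSubgraph.IsInduced ∧ ∀ w : V, IsHDV G w → w ∈ p.support

/-- Isomorphism, as an equivalence relation on the graphs with vertex set `Fin n` that satisfy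
`Q`. -/
def isoSetoid (n : ℕ) (Q : SimpleGraph (Fin n) → Prop) :
    Setoid {G : SimpleGraph (Fin n) // Q G} where
  r G H := Nonempty (G.1 ≃g H.1)
  iseqv :=
    { refl := fun _ => ⟨SimpleGraph.Iso.refl⟩
      symm := fun ⟨e⟩ => ⟨e.symm⟩
      trans := fun ⟨e⟩ ⟨f⟩ => ⟨f.comp e⟩ }

/-- The number of isomorphism classes of graphs on `n` vertices that satisfy `Q`. -/
noncomputable def isoClassCount (n : ℕ) (Q : SimpleGraph (Fin n) → Prop) : ℕ :=
  Nat.card (Quotient (isoSetoid n Q))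

/-- The number of non-isomorphic linear trees on `n` vertices. -/
noncomputable def linearTreeCount (n : ℕ) : ℕ :=
  isoClassCount n (fun G => IsLinearTree G)

/-- The number of non-isomorphic trees on `n` vertices. -/
noncomputable def treeCount (n : ℕ) : ℕ :=
  isoClassCount n (fun G => G.IsTree)

/-- The partition generating function `P(x) = ∏_{i ≥ 1} 1 / (1 - x ^ i)`. -/
noncomputable def P (x : ℝ) : ℝ := ∏' i : ℕ, 1 / (1 - x ^ (i + 1))

/-- The constant `(1/2) (P(x) - 1/(1-x))² · x / (P(x) + x P'(x))`. -/
noncomputable def leadingConstant (x : ℝ) : ℝ :=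
  1 / 2 * (P x - 1 / (1 - x)) ^ 2 * (x / (P x + x * deriv P x))

end LinearTrees

/-!
A linear tree with at least two vertices of degree at least three is a chain of spiders: the path
joining its two extreme high degree vertices is the *spine*, and what is attached to a spine vertex
is a set of paths, its *legs*. The multiset of leg lengths at a spine vertex is a partition, so the
tree is coded by a list of partitions, of weight `∑ (1 + |λᵢ|)`. The spine is determined by the
tree, hence the code is determined up to reversal, and the codes that occur are the lists of length
at least two whose first and last partitions have at least two parts
(`IsLinearTree.exists_chain`, `nonempty_iso_iff`). Consequently `2 aₙ` is the number of codes plus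
the number of palindromic codes, up to a term bounded by the number of partitions of `n - 1` that
accounts for the trees with at most one high degree vertex (`two_mul_linearTreeCount_bounds`).

The number `cₙ` of lists of partitions of weight `n` satisfies the renewal equation
`cₙ = ∑ p(k) cₙ₋₁₋ₖ`. Since `x₀ P(x₀) = 1`, the numbers `p(k) x₀ ^ (k + 1)` form a probability
distribution, of mean `1 + x₀² P'(x₀)`, and the renewal theorem (`renewal_theorem`) gives
`cₙ x₀ ^ n → 1 / (1 + x₀² P'(x₀))`. The partitions with at least two parts have generating function
`P(x) - 1 / (1 - x)`, so putting one of them at each end of a list multiplies the limit by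
`(x₀ (P(x₀) - 1 / (1 - x₀)))²`. Palindromes and the correction term grow more slowly, which proves
the asymptotic formula.

For the numerical values `P` is enclosed between a finite product and the same product with a
geometric estimate of the tail, and `P'` between the slopes of two chords, `P` being convex.

For the comparison with all trees, a tree with levels of prescribed sizes and arbitrary parent maps
between consecutive levels gives `(24 ^ 24) ^ h` rooted trees on about `24 h` vertices, while an
isomorphism class contains at most `n (24!) ^ (h + 1)` of them (`pow_le_treeCount`). As
`24! / x₀ ^ 24 < 24 ^ 24`, the number of trees grows faster than `x₀ ^ (-n)`.
-/

namespace LinearTrees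

open Finset.HasAntidiagonal (antidiagonal mem_antidiagonal)

/-! ### Rooted trees described by a parent map -/

/-- `G` is a tree rooted at `r`: every vertex `v ≠ r` has a parent `par v` that is one level
closer to `r`, and the edges of `G` are exactly the pairs `{v, par v}` with `v ≠ r`. By convention
the root is its own parent. -/
structure IsRooting {V : Type*} (G : SimpleGraph V) (r : V) (par : V → V) (lev : V → ℕ) :
    Prop where
  par_root : par r = r
  lev_root : lev r = 0
  lev_par : ∀ v, v ≠ r → lev v = lev (par v) + 1
  adj_iff : ∀ v w, G.Adj v w ↔ (v ≠ r ∧ par v = w) ∨ (w ≠ r ∧ par w = v)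

/-- The graph that joins every vertex `v ≠ r` to its parent. -/
def parentGraph {V : Type*} (r : V) (par : V → V) : SimpleGraph V where
  Adj v w := v ≠ w ∧ ((v ≠ r ∧ par v = w) ∨ (w ≠ r ∧ par w = v))
  symm := ⟨fun _ _ h => ⟨h.1.symm, h.2.symm⟩⟩
  loopless := ⟨fun _ h => h.1 rfl⟩

lemma isRooting_parentGraph {V : Type*} {r : V} {par : V → V} {lev : V → ℕ}
    (h1 : par r = r) (h2 : lev r = 0) (h3 : ∀ v, v ≠ r → lev v = lev (par v) + 1) :
    IsRooting (parentGraph r par) r par lev where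
  par_root := h1
  lev_root := h2
  lev_par := h3
  adj_iff v w := by
    refine ⟨fun h => h.2, fun h => ⟨?_, h⟩⟩
    rintro rfl
    obtain ⟨hv, h⟩ : v ≠ r ∧ par v = v := by tauto
    have := h3 v hv
    rw [h] at this
    omega

namespace IsRooting

variable {V W : Type*} {G : SimpleGraph V} {H : SimpleGraph W} {r : V} {s : W}
  {par : V → V} {parH : W → W} {lev : V → ℕ} {levH : W → ℕ}

lemma adj_par (h : IsRooting G r par lev) {v : V} (hv : v ≠ r) : G.Adj v (par v) :=
  (h.adj_iff _ _).2 (Or.inl ⟨hv, rfl⟩)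

lemma lev_eq_zero_iff (h : IsRooting G r par lev) {v : V} : lev v = 0 ↔ v = r := by
  constructor
  · intro h0
    by_contra hv
    have := h.lev_par v hv
    omega
  · rintro rfl
    exact h.lev_root

lemma lev_par_eq (h : IsRooting G r par lev) (v : V) : lev (par v) = lev v - 1 := by
  by_cases hv : v = r
  · rw [hv, h.par_root, h.lev_root]
  · have := h.lev_par v hv
    omega

lemma lev_iterate (h : IsRooting G r par lev) (v : V) (k : ℕ) :
    lev (par^[k] v) = lev v - k := by
  induction k with
  | zero => simp
  | succ k ih => rw [Function.iterate_succ_apply', h.lev_par_eq, ih]; omega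

lemma iterate_root (h : IsRooting G r par lev) (k : ℕ) : par^[k] r = r :=
  Function.iterate_fixed h.par_root k

lemma iterate_lev (h : IsRooting G r par lev) (v : V) : par^[lev v] v = r := by
  rw [← h.lev_eq_zero_iff, h.lev_iterate]; omega

/-- The walk from `v` up to the root is an induced path through the ancestors of `v`. -/
lemma exists_ancestor_path (h : IsRooting G r par lev) (v : V) :
    ∃ p : G.Walk v r, p.IsPath ∧ (∀ w, w ∈ p.support ↔ ∃ k, par^[k] v = w) ∧
      p.length = lev v ∧ ∀ x ∈ p.support, x ≠ r → p.toSubgraph.Adj x (par x) := by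
  induction hn : lev v generalizing v with
  | zero =>
    obtain rfl := h.lev_eq_zero_iff.1 hn
    refine ⟨.nil, .nil, fun w => ?_, rfl, fun x hx hxr => ?_⟩
    · simp [h.iterate_root, eq_comm]
    · simp at hx; exact absurd hx hxr
  | succ n ih =>
    have hv : v ≠ r := by
      intro hv; rw [h.lev_eq_zero_iff.2 hv] at hn; omega
    obtain ⟨p, hp, hs, hl, hadj⟩ := ih (par v) (by rw [h.lev_par_eq, hn]; rfl)
    refine ⟨.cons (h.adj_par hv) p, ?_, fun w => ?_, by simp [hl], fun x hx hxr => ?_⟩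
    · rw [SimpleGraph.Walk.cons_isPath_iff]
      refine ⟨hp, fun hmem => ?_⟩
      obtain ⟨k, hk⟩ := (hs v).1 hmem
      have := congrArg lev hk
      rw [h.lev_iterate, h.lev_par_eq] at this
      omega
    · rw [SimpleGraph.Walk.support_cons, List.mem_cons, hs]
      constructor
      · rintro (rfl | ⟨k, hk⟩)
        · exact ⟨0, rfl⟩
        · exact ⟨k + 1, hk⟩
      · rintro ⟨k, hk⟩
        cases k with
        | zero => exact Or.inl hk.symm
        | succ k => exact Or.inr ⟨k, hk⟩
    · rw [SimpleGraph.Walk.toSubgraph, SimpleGraph.Subgraph.sup_adj]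
      rw [SimpleGraph.Walk.support_cons, List.mem_cons] at hx
      rcases hx with rfl | hx
      · left; simp
      · right; exact hadj x hx hxr

lemma connected (h : IsRooting G r par lev) : G.Connected := by
  have : Nonempty V := ⟨r⟩
  refine ⟨fun v w => ?_⟩
  obtain ⟨p, -⟩ := h.exists_ancestor_path v
  obtain ⟨q, -⟩ := h.exists_ancestor_path w
  exact ⟨p.append q.reverse⟩

lemma isTree [Finite V] (h : IsRooting G r par lev) : G.IsTree := by
  rw [SimpleGraph.isTree_iff_connected_and_card]
  refine ⟨h.connected, le_antisymm ?_ h.connected.card_vert_le_card_edgeSet_add_one⟩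
  have hsurj : Function.Surjective
      (fun v : {v : V // v ≠ r} => (⟨s(v.1, par v.1), h.adj_par v.2⟩ : G.edgeSet)) := by
    rintro ⟨e, he⟩
    induction e with
    | _ v w =>
      rcases (h.adj_iff v w).1 he with ⟨hv, rfl⟩ | ⟨hw, rfl⟩
      · exact ⟨⟨v, hv⟩, rfl⟩
      · exact ⟨⟨w, hw⟩, Subtype.ext Sym2.eq_swap⟩
  have h1 : Nat.card G.edgeSet ≤ Nat.card {v : V // v ≠ r} :=
    Nat.card_le_card_of_surjective _ hsurj
  have h2 : Nat.card {v : V // v ≠ r} + 1 = Nat.card V := by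
    classical
    have := Fintype.ofFinite V
    have : 0 < Fintype.card V := Fintype.card_pos_iff.2 ⟨r⟩
    rw [Nat.card_eq_fintype_card, Nat.card_eq_fintype_card, Fintype.card_subtype_compl,
      Fintype.card_subtype_eq]
    omega
  omega

/-- Every finite tree is rooted at any of its vertices, the level being the distance. -/
lemma of_isTree (hG : G.IsTree) (r : V) :
    ∃ par : V → V, IsRooting G r par (fun v => G.dist r v) := by
  classical
  have hex : ∀ v : V, v ≠ r → ∃ w, G.Adj v w ∧ G.dist r v = G.dist r w + 1 := by
    intro v hv
    obtain ⟨p, hp⟩ := hG.connected.exists_walk_length_eq_dist v r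
    cases p with
    | nil => exact absurd rfl hv
    | cons hadj q =>
      refine ⟨_, hadj, ?_⟩
      have h1 := SimpleGraph.dist_le q
      rw [SimpleGraph.Walk.length_cons] at hp
      rw [SimpleGraph.dist_comm] at h1
      rw [SimpleGraph.dist_comm] at hp
      rcases hG.dist_eq_dist_add_one_of_adj r hadj with h2 | h2
      · exact h2
      · omega
  have huniq : ∀ v w w' : V, G.Adj v w → G.Adj v w' → G.dist r v = G.dist r w + 1 →
      G.dist r v = G.dist r w' + 1 → w = w' := by
    intro v w w' hw hw' hd hd'
    obtain ⟨p, hp⟩ := hG.connected.exists_walk_length_eq_dist w r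
    obtain ⟨p', hp'⟩ := hG.connected.exists_walk_length_eq_dist w' r
    have e1 : (SimpleGraph.Walk.cons hw p).IsPath :=
      SimpleGraph.Walk.isPath_of_length_eq_dist _ (by
        rw [SimpleGraph.Walk.length_cons, hp, SimpleGraph.dist_comm, ← hd,
          SimpleGraph.dist_comm])
    have e2 : (SimpleGraph.Walk.cons hw' p').IsPath :=
      SimpleGraph.Walk.isPath_of_length_eq_dist _ (by
        rw [SimpleGraph.Walk.length_cons, hp', SimpleGraph.dist_comm, ← hd',
          SimpleGraph.dist_comm])
    have := (hG.existsUnique_path v r).unique e1 e2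
    have := congrArg (fun q : G.Walk v r => q.snd) this
    simpa using this
  choose f hf using hex
  refine ⟨fun v => if hv : v = r then r else f v hv, by simp, by simp, fun v hv => ?_,
    fun v w => ?_⟩
  · simp only [hv, dite_false]; exact (hf v hv).2
  · constructor
    · intro hadj
      rcases hG.dist_eq_dist_add_one_of_adj r hadj with h2 | h2
      · have hv : v ≠ r := by rintro rfl; simp at h2
        left; simp only [hv, dite_false]
        exact ⟨hv, huniq v _ _ (hf v hv).1 hadj (hf v hv).2 h2⟩
      · have hw : w ≠ r := by rintro rfl; simp at h2
        right; simp only [hw, dite_false]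
        exact ⟨hw, huniq w _ _ (hf w hw).1 hadj.symm (hf w hw).2 h2⟩
    · rintro (⟨hv, h⟩ | ⟨hw, h⟩)
      · simp only [hv, dite_false] at h; exact h ▸ (hf v hv).1
      · simp only [hw, dite_false] at h; exact (h ▸ (hf w hw).1).symm

/-- In a rooted tree the vertices of a path ending at the root are the ancestors of its start. -/
lemma mem_support_iff [Finite V] (h : IsRooting G r par lev) {v : V} (p : G.Walk v r)
    (hp : p.IsPath) (w : V) : w ∈ p.support ↔ ∃ k, par^[k] v = w := by
  obtain ⟨q, hq, hs, -⟩ := h.exists_ancestor_path v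
  rw [(h.isTree.existsUnique_path v r).unique hp hq, hs]

/-- Isomorphisms that preserve the root commute with the parent maps and preserve levels. -/
lemma iso_par_lev (h : IsRooting G r par lev) (hH : IsRooting H s parH levH) (σ : G ≃g H)
    (hσ : σ r = s) (v : V) : σ (par v) = parH (σ v) ∧ levH (σ v) = lev v := by
  induction hn : lev v using Nat.strong_induction_on generalizing v with
  | _ n ih =>
    by_cases hv : v = r
    · subst hv; subst hσ
      rw [h.par_root, hH.par_root, hH.lev_root]
      exact ⟨rfl, by rw [← hn, h.lev_root]⟩
    · have hl := h.lev_par v hv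
      obtain ⟨h1, h2⟩ := ih (lev (par v)) (by omega) (par v) rfl
      have hadj : H.Adj (σ v) (σ (par v)) := σ.map_adj_iff.2 (h.adj_par hv)
      rcases (hH.adj_iff _ _).1 hadj with ⟨h3, h4⟩ | ⟨h3, h4⟩
      · refine ⟨h4.symm, ?_⟩
        rw [hH.lev_par _ h3, h4, h2]; omega
      · -- otherwise `v` would be the grandparent of itself
        rw [← h1] at h4
        have h5 := σ.injective h4
        have h6 := h.lev_par_eq (par v)
        rw [h5] at h6
        omega

/-- A bijection that preserves the root and commutes with the parent maps is an isomorphism. -/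
def isoOfPar (h : IsRooting G r par lev) (hH : IsRooting H s parH levH) (e : V ≃ W)
    (hr : e r = s) (hpar : ∀ v, e (par v) = parH (e v)) : G ≃g H where
  toEquiv := e
  map_rel_iff' := by
    intro v w
    have hne : ∀ x, e x ≠ s ↔ x ≠ r := fun x => by rw [← hr, e.injective.ne_iff]
    rw [h.adj_iff, hH.adj_iff, hne, hne, ← hpar, ← hpar, e.injective.eq_iff, e.injective.eq_iff]

end IsRooting

/-! ### Chains of spiders -/

/-- A chain of spiders: a path on the vertices `0, …, m`, the spine, together with finitely many
legs. The leg `a` is a path on `len a` further vertices, one end of which is joined to the vertex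
`base a` of the spine. -/
structure Chain where
  m : ℕ
  A : Type
  [fintypeA : Fintype A]
  base : A → ℕ
  len : A → ℕ
  base_le : ∀ a, base a ≤ m
  len_pos : ∀ a, 0 < len a

namespace Chain

attribute [instance] Chain.fintypeA

variable (C D : Chain)

/-- The vertices of a chain: those of the spine, and the pairs `⟨a, k⟩` with `k < len a`; the
vertices of a leg are counted from its tip `⟨a, 0⟩`. -/
abbrev V : Type := Fin (C.m + 1) ⊕ (Σ a : C.A, Fin (C.len a))

/-- The first vertex of the spine, taken as the root. -/
abbrev start : C.V := Sum.inl 0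

/-- The last vertex of the spine. -/
abbrev finish : C.V := Sum.inl (Fin.last C.m)

/-- The parent of a vertex, seen from the first vertex of the spine. -/
def par : C.V → C.V
  | .inl i => .inl ⟨i.1 - 1, by omega⟩
  | .inr ⟨a, k⟩ => if h : k.1 + 1 < C.len a then .inr ⟨a, ⟨k.1 + 1, h⟩⟩
      else .inl ⟨C.base a, Nat.lt_succ_of_le (C.base_le a)⟩

/-- The distance of a vertex from the first vertex of the spine. -/
def lev : C.V → ℕ
  | .inl i => i.1
  | .inr ⟨a, k⟩ => C.base a + (C.len a - k.1)

/-- The tree described by a chain. -/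
def graph : SimpleGraph C.V := parentGraph C.start C.par

lemma isRooting : IsRooting C.graph C.start C.par C.lev := by
  refine isRooting_parentGraph rfl rfl ?_
  rintro (i | ⟨a, k⟩) hv
  · have : i.1 ≠ 0 := fun h => hv (by rw [start, Sum.inl.injEq]; exact Fin.ext h)
    simp only [par, lev]; omega
  · have := k.2
    simp only [par]
    split_ifs with h <;> simp only [lev] <;> omega

lemma card_V : Fintype.card C.V = C.m + 1 + ∑ a, C.len a := by
  simp [V, Fintype.card_sum, Fintype.card_sigma]

lemma par_iterate_inl (i : Fin (C.m + 1)) (k : ℕ) :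
    C.par^[k] (.inl i) = .inl ⟨i.1 - k, by omega⟩ := by
  induction k with
  | zero => rfl
  | succ k ih => rw [Function.iterate_succ_apply', ih]; simp only [par]; congr 2

lemma par_iterate_finish (i : Fin (C.m + 1)) : C.par^[C.m - i.1] C.finish = .inl i := by
  rw [finish, par_iterate_inl]
  congr 1
  ext
  simp only [Fin.val_last]; omega

/-- The spine consists of the ancestors of its last vertex. -/
lemma exists_iterate_finish_iff (v : C.V) : (∃ k, C.par^[k] C.finish = v) ↔ ∃ i, v = .inl i := by
  constructor
  · rintro ⟨k, rfl⟩
    exact ⟨_, C.par_iterate_inl _ k⟩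
  · rintro ⟨i, rfl⟩
    exact ⟨_, C.par_iterate_finish i⟩

lemma par_iterate_tip (a : C.A) {k : ℕ} (hk : k < C.len a) :
    C.par^[k] (.inr ⟨a, ⟨0, C.len_pos a⟩⟩) = .inr ⟨a, ⟨k, hk⟩⟩ := by
  induction k with
  | zero => rfl
  | succ k ih =>
    rw [Function.iterate_succ_apply', ih (by omega)]
    simp only [par, hk, dite_true]

lemma par_iterate_len (a : C.A) :
    C.par^[C.len a] (.inr ⟨a, ⟨0, C.len_pos a⟩⟩) =
      .inl ⟨C.base a, Nat.lt_succ_of_le (C.base_le a)⟩ := by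
  have h0 := C.len_pos a
  have h := C.par_iterate_tip a (k := C.len a - 1) (by omega)
  have h1 : C.par^[C.len a - 1 + 1] (.inr ⟨a, ⟨0, C.len_pos a⟩⟩) =
      .inl ⟨C.base a, Nat.lt_succ_of_le (C.base_le a)⟩ := by
    rw [Function.iterate_succ_apply', h]
    have : ¬ (C.len a - 1 + 1 < C.len a) := by omega
    simp only [par, this, dite_false]
  rwa [Nat.sub_add_cancel h0] at h1

/-- The tips of the legs are the vertices off the spine without children. -/
lemma childless_iff (v : C.V) :
    ((∀ i, v ≠ .inl i) ∧ ∀ w, C.par w ≠ v) ↔ ∃ a, v = .inr ⟨a, ⟨0, C.len_pos a⟩⟩ := by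
  constructor
  · rintro ⟨h1, h2⟩
    obtain i | ⟨a, k⟩ := v
    · exact absurd rfl (h1 i)
    · refine ⟨a, ?_⟩
      by_contra hne
      have hk : k.1 ≠ 0 := fun h => hne (by congr 2; exact Fin.ext h)
      refine h2 (.inr ⟨a, ⟨k.1 - 1, by omega⟩⟩) ?_
      have h3 : k.1 - 1 + 1 < C.len a := by omega
      simp only [par, h3, dite_true]
      congr 3; omega
  · rintro ⟨a, rfl⟩
    refine ⟨by simp, ?_⟩
    rintro (i | ⟨b, k⟩) h
    · simp [par] at h
    · simp only [par] at h
      split_ifs at h with h3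
      rw [Sum.inr.injEq, Sigma.mk.injEq] at h
      obtain ⟨rfl, h⟩ := h
      simp at h

variable {C D}

/-- Two chains of the same length with the same numbers of legs of each length at each place have
isomorphic trees, and the isomorphism preserves both ends of the spine. -/
lemma exists_iso_of_equiv (hm : C.m = D.m) (e : C.A ≃ D.A) (hb : ∀ a, D.base (e a) = C.base a)
    (hl : ∀ a, D.len (e a) = C.len a) : Nonempty (C.graph ≃g D.graph) := by
  let f : C.V ≃ D.V := Equiv.sumCongr (finCongr (by rw [hm]))
    (Equiv.sigmaCongr e fun a => finCongr (hl a).symm)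
  have hf : ∀ a k, f (.inr ⟨a, k⟩) = .inr ⟨e a, ⟨k.1, by rw [hl]; exact k.2⟩⟩ := fun a k => rfl
  have hf' : ∀ i, f (.inl i) = .inl ⟨i.1, by omega⟩ := fun i => rfl
  refine ⟨C.isRooting.isoOfPar D.isRooting f rfl ?_⟩
  rintro (i | ⟨a, k⟩)
  · simp only [hf', par]
  · by_cases h : k.1 + 1 < C.len a
    · have h' : k.1 + 1 < D.len (e a) := by rw [hl]; exact h
      simp only [hf, par, h, h', dite_true]
    · have h' : ¬ k.1 + 1 < D.len (e a) := by rw [hl]; exact h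
      simp only [hf, hf', par, h, h', dite_false, hb]

/-- The isomorphisms that preserve both ends of the spine match the legs of the two chains. -/
lemma exists_equiv_of_iso (σ : C.graph ≃g D.graph) (h0 : σ C.start = D.start)
    (h1 : σ C.finish = D.finish) : C.m = D.m ∧ ∃ e : C.A ≃ D.A,
      (∀ a, D.base (e a) = C.base a) ∧ ∀ a, D.len (e a) = C.len a := by
  have hσ := C.isRooting.iso_par_lev D.isRooting σ h0
  have hm : C.m = D.m := by
    have := (hσ C.finish).2
    rw [h1] at this
    simpa [lev] using this.symm
  have hit : ∀ k v, σ (C.par^[k] v) = D.par^[k] (σ v) := by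
    intro k v
    induction k with
    | zero => rfl
    | succ k ih => rw [Function.iterate_succ_apply', Function.iterate_succ_apply', (hσ _).1, ih]
  have hsp : ∀ v, (∃ i, σ v = .inl i) ↔ ∃ i, v = .inl i := by
    intro v
    rw [← D.exists_iterate_finish_iff, ← C.exists_iterate_finish_iff]
    simp only [← h1, ← hit, σ.injective.eq_iff]
  have htip : ∀ v, (∃ a, σ v = .inr ⟨a, ⟨0, D.len_pos a⟩⟩) ↔
      ∃ a, v = .inr ⟨a, ⟨0, C.len_pos a⟩⟩ := by
    intro v
    rw [← D.childless_iff, ← C.childless_iff]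
    have := hsp v
    refine and_congr (by simpa only [not_exists] using not_congr this) ?_
    rw [σ.surjective.forall]
    refine forall_congr' fun w => ?_
    have h2 := (hσ w).1
    rw [← h2, σ.injective.ne_iff]
  choose e he using fun a => (htip (.inr ⟨a, ⟨0, C.len_pos a⟩⟩)).2 ⟨a, rfl⟩
  have hinj : Function.Injective e := by
    intro a b hab
    have h2 : σ (.inr ⟨a, ⟨0, C.len_pos a⟩⟩) = σ (.inr ⟨b, ⟨0, C.len_pos b⟩⟩) := by
      rw [he, he, hab]
    have h3 := σ.injective h2
    rw [Sum.inr.injEq, Sigma.mk.injEq] at h3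
    exact h3.1
  have hsurj : Function.Surjective e := by
    intro b
    obtain ⟨v, hv⟩ := σ.surjective (.inr ⟨b, ⟨0, D.len_pos b⟩⟩)
    obtain ⟨a, rfl⟩ := (htip v).1 ⟨b, hv⟩
    rw [he, Sum.inr.injEq, Sigma.mk.injEq] at hv
    exact ⟨a, hv.1⟩
  have key : ∀ a, D.par^[C.len a] (.inr ⟨e a, ⟨0, D.len_pos _⟩⟩) =
      σ (.inl ⟨C.base a, Nat.lt_succ_of_le (C.base_le a)⟩) := by
    intro a
    rw [← C.par_iterate_len a, hit, he]
  have hlen : ∀ a, D.len (e a) = C.len a := by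
    intro a
    refine le_antisymm ?_ ?_
    · by_contra hlt
      have h2 := key a
      rw [D.par_iterate_tip (e a) (not_le.1 hlt)] at h2
      obtain ⟨i, hi⟩ := (hsp (.inl ⟨C.base a, Nat.lt_succ_of_le (C.base_le a)⟩)).2 ⟨_, rfl⟩
      rw [hi] at h2
      simp at h2
    · by_contra hlt
      have h2 := D.par_iterate_len (e a)
      rw [← he, ← hit, C.par_iterate_tip a (not_le.1 hlt)] at h2
      obtain ⟨i, hi⟩ := (hsp _).1 ⟨_, h2⟩
      simp at hi
  refine ⟨hm, Equiv.ofBijective e ⟨hinj, hsurj⟩, fun a => ?_, hlen⟩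
  have h2 := key a
  rw [← hlen a, D.par_iterate_len] at h2
  have h3 := (hσ (.inl ⟨C.base a, Nat.lt_succ_of_le (C.base_le a)⟩)).2
  rw [← h2] at h3
  simp only [lev] at h3
  exact h3

/-- The chain read from its other end. -/
def rev (C : Chain) : Chain where
  m := C.m
  A := C.A
  base a := C.m - C.base a
  len := C.len
  base_le _ := Nat.sub_le _ _
  len_pos := C.len_pos

lemma adj_inl_inl (i j : Fin (C.m + 1)) :
    C.graph.Adj (.inl i) (.inl j) ↔ i.1 + 1 = j.1 ∨ j.1 + 1 = i.1 := by
  rw [C.isRooting.adj_iff]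
  simp only [start, par, ne_eq, Sum.inl.injEq, Fin.ext_iff, Fin.val_zero]
  omega

lemma adj_inr_inl (a : C.A) (k : Fin (C.len a)) (i : Fin (C.m + 1)) :
    C.graph.Adj (.inr ⟨a, k⟩) (.inl i) ↔ k.1 + 1 = C.len a ∧ C.base a = i.1 := by
  rw [C.isRooting.adj_iff]
  have := k.2
  simp only [par]
  split_ifs with h
  · simp only [ne_eq, reduceCtorEq, and_false, or_self, false_iff, not_and]
    omega
  · simp only [ne_eq, reduceCtorEq, not_false_eq_true, Sum.inl.injEq, Fin.ext_iff, true_and,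
      and_false, or_false]
    omega

lemma adj_inr_inr (a b : C.A) (k : Fin (C.len a)) (l : Fin (C.len b)) :
    C.graph.Adj (.inr ⟨a, k⟩) (.inr ⟨b, l⟩) ↔ a = b ∧ (k.1 + 1 = l.1 ∨ l.1 + 1 = k.1) := by
  rw [C.isRooting.adj_iff]
  have hk := k.2
  have hl := l.2
  have key : ∀ (a b : C.A) (k : Fin (C.len a)) (l : Fin (C.len b)),
      C.par (.inr ⟨a, k⟩) = .inr ⟨b, l⟩ ↔ a = b ∧ k.1 + 1 = l.1 := by
    intro a b k l
    simp only [par]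
    have hl := l.2
    split_ifs with h
    · rw [Sum.inr.injEq, Sigma.mk.injEq]
      refine and_congr_right ?_
      rintro rfl
      rw [heq_iff_eq, Fin.ext_iff]
    · simp only [false_iff, not_and]
      rintro rfl; omega
  rw [key, key]
  simp only [start, ne_eq, reduceCtorEq, not_false_eq_true, true_and, eq_comm (a := b)]
  tauto

/-- Reading a chain from its other end does not change the tree. -/
lemma exists_iso_rev (C : Chain) :
    ∃ σ : C.graph ≃g C.rev.graph, σ C.start = C.rev.finish ∧ σ C.finish = C.rev.start := by
  obtain ⟨D, hD⟩ : ∃ D, D = C.rev := ⟨_, rfl⟩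
  have hm : D.m = C.m := by rw [hD]; rfl
  obtain ⟨e, hb, hl⟩ : ∃ e : C.A ≃ D.A, (∀ a, D.base (e a) = C.m - C.base a) ∧
      ∀ a, D.len (e a) = C.len a := by
    subst hD; exact ⟨Equiv.refl _, fun _ => rfl, fun _ => rfl⟩
  rw [← hD]
  let f : C.V ≃ D.V := Equiv.sumCongr (Fin.revPerm.trans (finCongr (by rw [hm])))
    (Equiv.sigmaCongr e fun a => finCongr (hl a).symm)
  have hf : ∀ a k, f (.inr ⟨a, k⟩) = .inr ⟨e a, ⟨k.1, by rw [hl]; exact k.2⟩⟩ := fun a k => rfl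
  have hf' : ∀ i, f (.inl i) = .inl ⟨C.m - i.1, by omega⟩ := fun i => by
    simp only [f, Equiv.sumCongr_apply, Sum.map_inl, Equiv.trans_apply, Fin.revPerm_apply,
      Sum.inl.injEq, Fin.ext_iff, finCongr_apply, Fin.val_cast, Fin.val_rev]
    omega
  have h3 : ∀ (a : C.A) (k : Fin (C.len a)) (i : Fin (C.m + 1)),
      D.graph.Adj (f (.inr ⟨a, k⟩)) (f (.inl i)) ↔ C.graph.Adj (.inr ⟨a, k⟩) (.inl i) := by
    intro a k i
    have := C.base_le a
    have := i.2
    rw [hf, hf', adj_inr_inl, adj_inr_inl, hb]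
    simp only [hl]
    omega
  refine ⟨⟨f, ?_⟩, ?_, ?_⟩
  · rintro (i | ⟨a, k⟩) (j | ⟨b, l⟩)
    · have := i.2
      have := j.2
      rw [hf', hf', adj_inl_inl, adj_inl_inl]
      simp only
      omega
    · rw [SimpleGraph.adj_comm, h3]
      exact SimpleGraph.adj_comm _ _ _
    · exact h3 a k j
    · rw [hf, hf, adj_inr_inr, adj_inr_inr, e.injective.eq_iff]
  · change f (.inl 0) = _
    rw [hf', finish, Sum.inl.injEq, Fin.ext_iff]
    simp [hm]
  · change f (.inl (Fin.last _)) = _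
    rw [hf', start, Sum.inl.injEq, Fin.ext_iff]
    simp

end Chain

/-! ### High degree vertices and linear trees -/

lemma IsHDV.map_iso {V W : Type*} {G : SimpleGraph V} {H : SimpleGraph W} (σ : G ≃g H) {v : V}
    (h : IsHDV G v) : IsHDV H (σ v) := by
  unfold IsHDV at *
  rwa [← Set.encard_congr (σ.mapNeighborSet v)]

lemma isHDV_of_three {V : Type*} {G : SimpleGraph V} {v a b c : V} (ha : G.Adj v a)
    (hb : G.Adj v b) (hc : G.Adj v c) (hab : a ≠ b) (hac : a ≠ c) (hbc : b ≠ c) :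
    IsHDV G v := by
  classical
  unfold IsHDV
  have hsub : ((({a, b, c} : Finset V) : Set V)) ⊆ G.neighborSet v := by
    intro x hx
    simp only [Finset.coe_insert, Finset.coe_singleton, Set.mem_insert_iff,
      Set.mem_singleton_iff] at hx
    rcases hx with rfl | rfl | rfl <;> assumption
  refine le_trans ?_ (Set.encard_le_encard hsub)
  rw [Set.encard_coe_eq_coe_finsetCard, Finset.card_eq_three.2 ⟨a, b, c, hab, hac, hbc, rfl⟩]
  rfl

lemma IsHDV.card_le {V : Type*} {G : SimpleGraph V} {v : V} (h : IsHDV G v) (s : Finset V)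
    (hs : ∀ w, G.Adj v w → w ∈ s) : 3 ≤ s.card := by
  have h1 : (3 : ℕ∞) ≤ (s : Set V).encard := le_trans h (Set.encard_le_encard fun w hw => hs w hw)
  rw [Set.encard_coe_eq_coe_finsetCard] at h1
  exact_mod_cast h1

lemma IsRooting.exists_walk_iterate {V : Type*} {G : SimpleGraph V} {r : V} {par : V → V}
    {lev : V → ℕ} (h : IsRooting G r par lev) (v : V) (k : ℕ) :
    ∃ p : G.Walk v (par^[k] v), p.length ≤ k := by
  induction k with
  | zero => exact ⟨.nil, le_rfl⟩
  | succ k ih =>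
    obtain ⟨p, hp⟩ := ih
    rw [Function.iterate_succ_apply']
    by_cases hr : par^[k] v = r
    · rw [hr, h.par_root, ← hr]
      exact ⟨p, by omega⟩
    · exact ⟨p.concat (h.adj_par hr), by rw [SimpleGraph.Walk.length_concat]; omega⟩

lemma IsRooting.lev_le_of_walk {V : Type*} {G : SimpleGraph V} {r : V} {par : V → V}
    {lev : V → ℕ} (h : IsRooting G r par lev) {u v : V} (p : G.Walk u v) :
    lev v ≤ lev u + p.length := by
  induction p with
  | nil => simp
  | @cons u w v hadj p ih =>
    rw [SimpleGraph.Walk.length_cons]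
    rcases (h.adj_iff _ _).1 hadj with ⟨h1, rfl⟩ | ⟨h1, rfl⟩
    · have := h.lev_par _ h1; omega
    · have := h.lev_par _ h1; omega

/-- A tree with a path through all its high degree vertices is linear, since paths in trees are
induced. -/
lemma IsRooting.isLinearTree {V : Type*} [Finite V] {G : SimpleGraph V} {r : V} {par : V → V}
    {lev : V → ℕ} (h : IsRooting G r par lev) (e : V)
    (he : ∀ w, IsHDV G w → ∃ k, par^[k] e = w) : IsLinearTree G := by
  obtain ⟨p, hp, hs, -, hadj⟩ := h.exists_ancestor_path e
  refine ⟨h.isTree, e, r, p, hp, ?_, fun w hw => (hs w).2 (he w hw)⟩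
  intro x hx y hy hxy
  rw [SimpleGraph.Walk.mem_verts_toSubgraph] at hx hy
  rcases (h.adj_iff _ _).1 hxy with ⟨h1, rfl⟩ | ⟨h1, rfl⟩
  · exact hadj _ hx h1
  · exact (hadj _ hy h1).symm

namespace Chain

variable {C D : Chain}

/-- High degree vertices of a chain lie on the spine. -/
lemma exists_inl_of_isHDV {v : C.V} (hv : IsHDV C.graph v) : ∃ i, v = .inl i := by
  classical
  obtain i | ⟨a, k⟩ := v
  · exact ⟨i, rfl⟩
  · exfalso
    let s : Finset C.V := {C.par (.inr ⟨a, k⟩), .inr ⟨a, ⟨k.1 - 1, by omega⟩⟩}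
    have h1 := hv.card_le s ?_
    · have : s.card ≤ 2 := Finset.card_le_two
      omega
    · intro w hw
      rw [Finset.mem_insert, Finset.mem_singleton]
      rcases (C.isRooting.adj_iff _ _).1 hw with ⟨-, h⟩ | ⟨hw, h⟩
      · exact Or.inl h.symm
      · right
        obtain i | ⟨b, l⟩ := w
        · simp [par] at h
        · simp only [par] at h
          split_ifs at h with h3
          rw [Sum.inr.injEq, Sigma.mk.injEq] at h
          obtain ⟨rfl, h⟩ := h
          rw [heq_iff_eq, Fin.ext_iff] at h
          simp only at h
          congr 2
          ext
          simp only; omega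

/-- The number of legs at the vertex `i` of the spine. -/
def legCount (C : Chain) (i : ℕ) : ℕ := (Finset.univ.filter fun a => C.base a = i).card

/-- The end of a leg that is joined to the spine. -/
def foot (C : Chain) (a : C.A) : C.V :=
  .inr ⟨a, ⟨C.len a - 1, Nat.sub_lt (C.len_pos a) one_pos⟩⟩

lemma adj_foot {i : Fin (C.m + 1)} {a : C.A} (h : C.base a = i.1) :
    C.graph.Adj (.inl i) (C.foot a) := by
  rw [SimpleGraph.adj_comm, foot, adj_inr_inl]
  have := C.len_pos a
  exact ⟨by simp only; omega, h⟩

lemma foot_injective : Function.Injective C.foot := by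
  intro a b h
  rw [foot, foot, Sum.inr.injEq, Sigma.mk.injEq] at h
  exact h.1

/-- An end `i` of the spine, with neighbour `j` on the spine, has high degree if and only if it
carries at least two legs. -/
lemma isHDV_inl_iff {i j : Fin (C.m + 1)}
    (hj : ∀ l, (i.1 + 1 = l.1 ∨ l.1 + 1 = i.1) ↔ l = j) :
    IsHDV C.graph (.inl i) ↔ 2 ≤ C.legCount i.1 := by
  classical
  constructor
  · intro h
    have h1 := h.card_le
      (insert (.inl j) ((Finset.univ.filter fun a => C.base a = i.1).image C.foot)) ?_
    · have h2 := Finset.card_insert_le (Sum.inl j : C.V)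
        ((Finset.univ.filter fun a => C.base a = i.1).image C.foot)
      rw [Finset.card_image_of_injective _ foot_injective] at h2
      unfold legCount
      omega
    · rintro (l | ⟨a, k⟩) hw
      · rw [adj_inl_inl, hj] at hw
        rw [hw]; exact Finset.mem_insert_self _ _
      · rw [SimpleGraph.adj_comm, adj_inr_inl] at hw
        refine Finset.mem_insert_of_mem (Finset.mem_image.2 ⟨a, by simpa using hw.2, ?_⟩)
        rw [foot]
        congr 2
        ext
        simp only; omega
  · intro h
    obtain ⟨a, b, ha, hb, hab⟩ := Finset.one_lt_card_iff.1 h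
    simp only [Finset.mem_filter, Finset.mem_univ, true_and] at ha hb
    refine isHDV_of_three (a := .inl j) ?_ (adj_foot ha) (adj_foot hb) ?_ ?_
      (foot_injective.ne hab)
    · rw [adj_inl_inl, hj]
    · simp [foot]
    · simp [foot]

lemma isHDV_start_iff (h : C.m ≠ 0) : IsHDV C.graph C.start ↔ 2 ≤ C.legCount 0 :=
  isHDV_inl_iff (i := 0) (j := ⟨1, by omega⟩) (fun l => by
    rw [Fin.ext_iff]; simp only [Fin.val_zero]; omega)

lemma isHDV_finish_iff (h : C.m ≠ 0) : IsHDV C.graph C.finish ↔ 2 ≤ C.legCount C.m :=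
  isHDV_inl_iff (i := Fin.last _) (j := ⟨C.m - 1, by omega⟩) (fun l => by
    rw [Fin.ext_iff]; simp only [Fin.val_last]; omega)

/-- The ends of the first spine have distance `C.m`, and the spine of the second chain joins their
images. -/
lemma m_le_of_iso (σ : C.graph ≃g D.graph) {i j : Fin (D.m + 1)} (hi : σ C.start = .inl i)
    (hj : σ C.finish = .inl j) : C.m ≤ i.1 - j.1 + (j.1 - i.1) := by
  have key : ∀ i j : Fin (D.m + 1), j ≤ i →
      ∃ p : D.graph.Walk (.inl i) (.inl j), p.length ≤ i.1 - j.1 := by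
    intro i j hij
    obtain ⟨p, hp⟩ := D.isRooting.exists_walk_iterate (.inl i) (i.1 - j.1)
    have hend : D.par^[i.1 - j.1] (.inl i) = .inl j := by
      rw [par_iterate_inl]
      congr 1
      ext
      simp only
      have := Fin.le_def.1 hij
      omega
    exact ⟨p.copy rfl hend, by rwa [SimpleGraph.Walk.length_copy]⟩
  obtain ⟨p, hp⟩ : ∃ p : D.graph.Walk (.inl i) (.inl j),
      p.length ≤ i.1 - j.1 + (j.1 - i.1) := by
    rcases le_total j i with h | h
    · obtain ⟨p, hp⟩ := key i j h
      exact ⟨p, by omega⟩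
    · obtain ⟨p, hp⟩ := key j i h
      exact ⟨p.reverse, by rw [SimpleGraph.Walk.length_reverse]; omega⟩
  have h1 : σ.symm (.inl i) = C.start := by rw [← hi]; exact σ.symm_apply_apply _
  have h2 : σ.symm (.inl j) = C.finish := by rw [← hj]; exact σ.symm_apply_apply _
  have h3 := C.isRooting.lev_le_of_walk ((p.map σ.symm.toHom).copy h1 h2)
  rw [SimpleGraph.Walk.length_copy, SimpleGraph.Walk.length_map] at h3
  simp only [lev, Fin.val_last, Fin.val_zero] at h3
  omega

/-- If the ends of the spines have high degree, an isomorphism maps ends to ends. -/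
lemma iso_ends (σ : C.graph ≃g D.graph) (h1 : IsHDV C.graph C.start) (h2 : IsHDV C.graph C.finish)
    (h3 : IsHDV D.graph D.start) (h4 : IsHDV D.graph D.finish) :
    (σ C.start = D.start ∧ σ C.finish = D.finish) ∨
      (σ C.start = D.finish ∧ σ C.finish = D.start) := by
  obtain ⟨i, hi⟩ := exists_inl_of_isHDV (h1.map_iso σ)
  obtain ⟨j, hj⟩ := exists_inl_of_isHDV (h2.map_iso σ)
  obtain ⟨i', hi'⟩ := exists_inl_of_isHDV (h3.map_iso σ.symm)
  obtain ⟨j', hj'⟩ := exists_inl_of_isHDV (h4.map_iso σ.symm)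
  have e1 := m_le_of_iso σ hi hj
  have e2 := m_le_of_iso σ.symm hi' hj'
  have := i.2
  have := j.2
  have := i'.2
  have := j'.2
  have : (i.1 = 0 ∧ j.1 = D.m) ∨ (i.1 = D.m ∧ j.1 = 0) := by omega
  rw [hi, hj]
  simp only [start, finish, Sum.inl.injEq, Fin.ext_iff, Fin.val_zero, Fin.val_last]
  exact this

end Chain

section Classification

variable {V : Type} {G : SimpleGraph V} {r : V} {par : V → V} {lev : V → ℕ}

/-- If every vertex that is not an ancestor of `e` has at most one child, then the tree is a chain
of spiders whose spine joins the root to `e`: the legs correspond to the childless vertices that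
are not ancestors of `e`. -/
theorem IsRooting.exists_chain [Finite V] (h : IsRooting G r par lev) (e : V)
    (huniq : ∀ v w w', (¬ ∃ k, par^[k] e = v) → par w = v → par w' = v → w = w') :
    ∃ (C : Chain) (σ : C.graph ≃g G), σ C.start = r ∧ σ C.finish = e := by
  classical
  have := Fintype.ofFinite V
  -- the vertices of the spine
  set S : V → Prop := fun v => ∃ k, par^[k] e = v with hS
  have hSpar : ∀ v, S v → S (par v) := by
    rintro v ⟨k, rfl⟩
    exact ⟨k + 1, Function.iterate_succ_apply' _ _ _⟩
  have hSit : ∀ k v, S v → S (par^[k] v) := by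
    intro k v hv
    induction k with
    | zero => exact hv
    | succ k ih => rw [Function.iterate_succ_apply']; exact hSpar _ ih
  have hSr : S r := ⟨lev e, h.iterate_lev e⟩
  have hSlev : ∀ v, S v → lev v ≤ lev e ∧ par^[lev e - lev v] e = v := by
    rintro v ⟨k, rfl⟩
    rw [h.lev_iterate]
    refine ⟨Nat.sub_le _ _, ?_⟩
    rcases le_total k (lev e) with hk | hk
    · congr 2; omega
    · rw [Nat.sub_eq_zero_of_le hk, Nat.sub_zero, h.iterate_lev]
      obtain ⟨j, rfl⟩ := Nat.exists_eq_add_of_le' hk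
      rw [Function.iterate_add_apply, h.iterate_lev, h.iterate_root]
  have hex : ∀ v, ∃ k, S (par^[k] v) := fun v => ⟨lev v, by rw [h.iterate_lev]; exact hSr⟩
  -- the number of steps from `v` to the spine
  let len : V → ℕ := fun v => Nat.find (hex v)
  have hlen : ∀ v, S (par^[len v] v) := fun v => Nat.find_spec (hex v)
  have hlt : ∀ v k, k < len v ↔ ¬ S (par^[k] v) := by
    intro v k
    refine ⟨fun hk => Nat.find_min (hex v) hk, fun hk => ?_⟩
    by_contra hle
    obtain ⟨j, rfl⟩ := Nat.exists_eq_add_of_le' (not_lt.1 hle)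
    rw [Function.iterate_add_apply] at hk
    exact hk (hSit _ _ (hlen v))
  let C : Chain :=
    { m := lev e
      A := {t : V // ¬ S t ∧ ∀ w, par w ≠ t}
      base := fun t => lev (par^[len t.1] t.1)
      len := fun t => len t.1
      base_le := fun t => (hSlev _ (hlen t.1)).1
      len_pos := fun t => (hlt _ _).2 t.2.1 }
  let f : C.V → V := fun x => match x with
    | .inl i => par^[lev e - i.1] e
    | .inr ⟨t, k⟩ => par^[k.1] t.1
  -- off the spine the parent map is injective
  have hcancel : ∀ k x y, par^[k] x = par^[k] y → (∀ j, 0 < j → j ≤ k → ¬ S (par^[j] x)) →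
      x = y := by
    intro k
    induction k with
    | zero => intro x y hxy _; exact hxy
    | succ k ih =>
      intro x y hxy hns
      rw [Function.iterate_succ_apply, Function.iterate_succ_apply] at hxy
      have h1 := ih (par x) (par y) hxy fun j hj hjk => by
        have := hns (j + 1) (by omega) (by omega)
        rwa [Function.iterate_succ_apply] at this
      exact huniq (par x) x y (hns 1 one_pos (by omega)) rfl h1.symm
  -- legs with different tips are disjoint, since a tip has no children
  have htip : ∀ (t t' : {t : V // ¬ S t ∧ ∀ w, par w ≠ t}) (k k' : ℕ), k ≤ k' → k < len t.1 →
      par^[k] t.1 = par^[k'] t'.1 → t = t' ∧ k = k' := by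
    intro t t' k k' hkk hk heq
    obtain ⟨j, rfl⟩ := Nat.exists_eq_add_of_le hkk
    rw [Function.iterate_add_apply] at heq
    have h1 := hcancel k _ _ heq fun i _ hi => (hlt _ _).1 (by omega)
    cases j with
    | zero => exact ⟨Subtype.ext h1, rfl⟩
    | succ j =>
      rw [Function.iterate_succ_apply'] at h1
      exact absurd h1.symm (t.2.2 _)
  have hbij : Function.Bijective f := by
    constructor
    · have hs : ∀ i : Fin (C.m + 1), S (f (.inl i)) := fun i => ⟨_, rfl⟩
      have hns : ∀ x : (Σ a : C.A, Fin (C.len a)), ¬ S (f (.inr x)) :=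
        fun x => (hlt _ _).1 x.2.2
      rintro (i | ⟨t, k⟩) (j | ⟨t', k'⟩) hij
      · have h1 := congrArg lev hij
        have h2 : i.1 < lev e + 1 := i.2
        have h3 : j.1 < lev e + 1 := j.2
        simp only [f, h.lev_iterate] at h1
        congr 1; ext; omega
      · exact absurd (hij ▸ hs i) (hns ⟨t', k'⟩)
      · exact absurd (hij ▸ hs j) (hns ⟨t, k⟩)
      · have : t = t' ∧ k.1 = k'.1 := by
          rcases le_total k.1 k'.1 with hk | hk
          · exact htip t t' _ _ hk k.2 hij
          · have := htip t' t _ _ hk k'.2 hij.symm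
            exact ⟨this.1.symm, this.2.symm⟩
        obtain ⟨rfl, h2⟩ := this
        rw [Fin.ext h2]
    · intro v
      by_cases hv : S v
      · exact ⟨.inl ⟨lev v, Nat.lt_succ_of_le (hSlev v hv).1⟩, (hSlev v hv).2⟩
      · -- a descendant of `v` at maximal level is the tip of the leg through `v`
        obtain ⟨t, ht, hmax⟩ := Finset.exists_max_image
          (Finset.univ.filter fun w : V => ∃ k, par^[k] w = v) lev
          ⟨v, by simp only [Finset.mem_filter, Finset.mem_univ, true_and]; exact ⟨0, rfl⟩⟩
        simp only [Finset.mem_filter, Finset.mem_univ, true_and] at ht hmax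
        obtain ⟨k, hk⟩ := ht
        have hkl : k < len t := (hlt _ _).2 (by rw [hk]; exact hv)
        refine ⟨.inr ⟨⟨t, fun hSt => hv (hk ▸ hSit k t hSt), fun w hw => ?_⟩, ⟨k, hkl⟩⟩, hk⟩
        have h1 := hmax w ⟨k + 1, by rw [Function.iterate_succ_apply, hw, hk]⟩
        have hwr : w ≠ r := by
          rintro rfl
          rw [h.par_root] at hw
          apply hv
          rw [← hk, ← hw, h.iterate_root]
          exact hSr
        have h2 := h.lev_par w hwr
        rw [hw] at h2
        omega
  let F : C.V ≃ V := Equiv.ofBijective f hbij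
  have h0 : f C.start = r := by
    change par^[lev e - 0] e = r
    rw [Nat.sub_zero, h.iterate_lev]
  refine ⟨C, C.isRooting.isoOfPar h F h0 ?_, h0, ?_⟩
  · rintro (i | ⟨t, k⟩)
    · change par^[lev e - (i.1 - 1)] e = par (par^[lev e - i.1] e)
      have h2 : i.1 < lev e + 1 := i.2
      rw [← Function.iterate_succ_apply' par]
      rcases Nat.eq_zero_or_pos i.1 with h3 | h3
      · rw [h3, Function.iterate_succ_apply', Nat.sub_zero, h.iterate_lev, h.par_root]
      · congr 2; omega
    · change f (C.par (.inr ⟨t, k⟩)) = par (par^[k.1] t.1)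
      rw [← Function.iterate_succ_apply' par]
      by_cases h3 : k.1 + 1 < C.len t
      · simp only [Chain.par, h3, dite_true]
        rfl
      · simp only [Chain.par, h3, dite_false]
        have h4 : k.1 + 1 = len t.1 := le_antisymm k.2 (not_lt.1 h3)
        rw [Nat.succ_eq_add_one, h4]
        exact (hSlev _ (hlen t.1)).2
  · change par^[lev e - (Fin.last (lev e)).1] e = e
    simp

end Classification

/-- Every finite linear tree is a chain of spiders, whose spine either is a single vertex or has
two ends of high degree. -/
theorem IsLinearTree.exists_chain {V : Type} [Finite V] {G : SimpleGraph V}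
    (hG : IsLinearTree G) : ∃ C : Chain, Nonempty (C.graph ≃g G) ∧
      (C.m = 0 ∨ (IsHDV C.graph C.start ∧ IsHDV C.graph C.finish)) := by
  classical
  obtain ⟨hT, u₀, v₀, p₀, hp₀, -, hh₀⟩ := hG
  -- a shortest path through all high degree vertices
  have hex : ∃ n, ∃ (u v : V) (p : G.Walk u v), p.IsPath ∧ (∀ w, IsHDV G w → w ∈ p.support) ∧
      p.length = n := ⟨_, u₀, v₀, p₀, hp₀, hh₀, rfl⟩
  obtain ⟨u, v, p, hp, hh, hn⟩ := Nat.find_spec hex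
  have hmin : ∀ (u' v' : V) (q : G.Walk u' v'), q.IsPath → (∀ w, IsHDV G w → w ∈ q.support) →
      p.length ≤ q.length := by
    intro u' v' q hq hhq
    rw [hn]
    exact Nat.find_min' hex ⟨u', v', q, hq, hhq, rfl⟩
  -- an end of low degree could be cut off
  have hends : ∀ (u v : V) (q : G.Walk u v), q.IsPath → (∀ w, IsHDV G w → w ∈ q.support) →
      q.length = p.length → q.length ≠ 0 → IsHDV G u := by
    intro u v q hq hhq hl hne
    by_contra hu
    cases q with
    | nil => exact hne rfl
    | cons hadj q =>
      have h1 := hmin _ _ q hq.of_cons fun w hw => by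
        have := hhq w hw
        rw [SimpleGraph.Walk.support_cons, List.mem_cons] at this
        rcases this with rfl | h
        · exact absurd hw hu
        · exact h
      rw [SimpleGraph.Walk.length_cons] at hl
      omega
  obtain ⟨par, h⟩ := IsRooting.of_isTree hT v
  have hsupp := h.mem_support_iff p hp
  have hlen : p.length = G.dist v u := by
    obtain ⟨q, hq, -, hql, -⟩ := h.exists_ancestor_path u
    rw [(hT.existsUnique_path u v).unique hp hq, hql]
  -- a vertex off the path has at most two neighbours, one of which is its parent
  have huniq : ∀ x w w', (¬ ∃ k, par^[k] u = x) → par w = x → par w' = x → w = w' := by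
    intro x w w' hx hw hw'
    by_contra hne
    refine hx ((hsupp x).1 (hh x ?_))
    have hxr : x ≠ v := by
      rintro rfl
      exact hx ⟨_, h.iterate_lev u⟩
    have hwr : ∀ w, par w = x → w ≠ v := by
      rintro w hw rfl
      rw [h.par_root] at hw
      exact hxr hw.symm
    have hwp : ∀ w, par w = x → par x ≠ w := by
      rintro w hw rfl
      have h3 := h.lev_par x hxr
      have h4 := h.lev_par (par x) (hwr _ hw)
      rw [hw] at h4
      omega
    refine isHDV_of_three (h.adj_par hxr) (?_ : G.Adj x w) (?_ : G.Adj x w') (hwp w hw)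
      (hwp w' hw') hne
    · exact hw ▸ (h.adj_par (hwr w hw)).symm
    · exact hw' ▸ (h.adj_par (hwr w' hw')).symm
  obtain ⟨C, σ, h1, h2⟩ := h.exists_chain u huniq
  refine ⟨C, ⟨σ⟩, ?_⟩
  by_cases hm : C.m = 0
  · exact Or.inl hm
  right
  have h3 : p.length = C.m := by
    have := (C.isRooting.iso_par_lev h σ h1 C.finish).2
    rw [h2] at this
    rw [hlen, this]
    simp [Chain.lev]
  have hu := hends u v p hp hh rfl (by omega)
  have hv := hends v u p.reverse hp.reverse (by simpa using hh) (by simp)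
    (by rw [SimpleGraph.Walk.length_reverse]; omega)
  have e1 : σ.symm v = C.start := by rw [← h1]; exact σ.symm_apply_apply _
  have e2 : σ.symm u = C.finish := by rw [← h2]; exact σ.symm_apply_apply _
  exact ⟨e1 ▸ hv.map_iso σ.symm, e2 ▸ hu.map_iso σ.symm⟩

/-! ### Codes of chains -/

/-- A partition: a finite multiset of positive integers, read as the lengths of the legs at one
vertex of the spine. -/
abbrev Legs : Type := {π : Multiset ℕ // 0 ∉ π}

/-- The number of vertices of a spider with given legs. -/
def Legs.weight (π : Legs) : ℕ := π.1.sum + 1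

/-- The number of vertices of a chain of spiders. -/
def weight (l : List Legs) : ℕ := (l.map Legs.weight).sum

namespace Chain

variable {C D : Chain}

/-- The lengths of the legs at the vertex `i` of the spine. -/
def legs (C : Chain) (i : ℕ) : Legs :=
  ⟨(Finset.univ.filter fun a => C.base a = i).val.map C.len, fun h => by
    obtain ⟨a, -, ha⟩ := Multiset.mem_map.1 h
    exact (C.len_pos a).ne' ha⟩

/-- The partitions met along the spine. -/
def code (C : Chain) : List Legs := (List.range (C.m + 1)).map C.legs

lemma length_code (C : Chain) : C.code.length = C.m + 1 := by simp [code]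

lemma getElem_code (C : Chain) (i : ℕ) (hi : i < C.code.length) : C.code[i] = C.legs i := by
  simp [code]

lemma card_legs (C : Chain) (i : ℕ) : (C.legs i).1.card = C.legCount i :=
  Multiset.card_map _ _

lemma count_legs (C : Chain) (i l : ℕ) :
    (C.legs i).1.count l = Fintype.card {a // (C.base a, C.len a) = (i, l)} := by
  classical
  rw [legs, Multiset.count_map, Fintype.card_subtype, ← Finset.filter_val, Finset.filter_filter,
    Finset.card_val]
  congr 1
  ext a
  simp [Prod.ext_iff, eq_comm]

lemma exists_equiv_of_code_eq (h : C.code = D.code) : C.m = D.m ∧ ∃ e : C.A ≃ D.A,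
    (∀ a, D.base (e a) = C.base a) ∧ ∀ a, D.len (e a) = C.len a := by
  have hm : C.m = D.m := by
    have := congrArg List.length h
    rw [length_code, length_code] at this
    omega
  have hlegs : ∀ i, C.legs i = D.legs i := by
    intro i
    by_cases hi : i < C.m + 1
    · have h1 := C.getElem_code i (by rw [length_code]; exact hi)
      have h2 := D.getElem_code i (by rw [length_code, ← hm]; exact hi)
      rw [← h1, ← h2]
      simp only [h]
    · -- no legs beyond the end of the spine
      have key : ∀ E : Chain, E.m = C.m → (E.legs i).1 = 0 := by
        intro E hE
        rw [← Multiset.card_eq_zero, card_legs, legCount, Finset.card_eq_zero,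
          Finset.filter_eq_empty_iff]
        intro a _
        have := E.base_le a
        omega
      exact Subtype.ext ((key C rfl).trans (key D hm.symm).symm)
  have hcard : ∀ c : ℕ × ℕ, Nonempty ({a // (C.base a, C.len a) = c} ≃
      {a // (D.base a, D.len a) = c}) := by
    rintro ⟨i, l⟩
    rw [← Fintype.card_eq, ← count_legs, ← count_legs, hlegs]
  let e : C.A ≃ D.A := Equiv.ofFiberEquiv (f := fun a => (C.base a, C.len a))
    (g := fun a => (D.base a, D.len a)) fun c => (hcard c).some
  have he : ∀ a, (D.base (e a), D.len (e a)) = (C.base a, C.len a) := fun a =>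
    Equiv.ofFiberEquiv_map (f := fun a => (C.base a, C.len a))
      (g := fun a => (D.base a, D.len a)) _ a
  exact ⟨hm, e, fun a => (Prod.ext_iff.1 (he a)).1, fun a => (Prod.ext_iff.1 (he a)).2⟩

lemma code_eq_of_equiv (hm : C.m = D.m) (e : C.A ≃ D.A) (hb : ∀ a, D.base (e a) = C.base a)
    (hl : ∀ a, D.len (e a) = C.len a) : C.code = D.code := by
  have hlegs : C.legs = D.legs := by
    funext i
    refine Subtype.ext (Multiset.ext.2 fun l => ?_)
    rw [count_legs, count_legs]
    exact Fintype.card_congr (e.subtypeEquiv fun a => by rw [hb, hl])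
  rw [code, code, hlegs, hm]

lemma exists_iso_of_code_eq (h : C.code = D.code) : Nonempty (C.graph ≃g D.graph) := by
  obtain ⟨hm, e, hb, hl⟩ := exists_equiv_of_code_eq h
  exact exists_iso_of_equiv hm e hb hl

lemma code_rev (C : Chain) : C.rev.code = C.code.reverse := by
  refine List.ext_getElem (by simp [length_code, rev]) fun i h1 h2 => ?_
  rw [List.getElem_reverse, getElem_code, getElem_code, length_code]
  rw [length_code] at h1
  have h3 : i < C.m + 1 := h1
  refine Subtype.ext ?_
  change (Finset.univ.filter fun a : C.A => C.m - C.base a = i).val.map C.len =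
    (Finset.univ.filter fun a : C.A => C.base a = C.m + 1 - 1 - i).val.map C.len
  congr 2
  refine Finset.filter_congr fun a _ => ?_
  have := C.base_le a
  omega

/-- Chains whose spines end in vertices of high degree have isomorphic trees if and only if their
codes agree up to reversal. -/
lemma nonempty_iso_iff (h1 : IsHDV C.graph C.start) (h2 : IsHDV C.graph C.finish)
    (h3 : IsHDV D.graph D.start) (h4 : IsHDV D.graph D.finish) :
    Nonempty (C.graph ≃g D.graph) ↔ D.code = C.code ∨ D.code = C.code.reverse := by
  constructor
  · rintro ⟨σ⟩
    rcases iso_ends σ h1 h2 h3 h4 with ⟨h5, h6⟩ | ⟨h5, h6⟩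
    · obtain ⟨hm, e, hb, hl⟩ := exists_equiv_of_iso σ h5 h6
      exact Or.inl (code_eq_of_equiv hm e hb hl).symm
    · obtain ⟨τ, h7, h8⟩ := D.exists_iso_rev
      obtain ⟨hm, e, hb, hl⟩ := exists_equiv_of_iso (σ.trans τ)
        ((congrArg τ h5).trans h8) ((congrArg τ h6).trans h7)
      right
      rw [code_eq_of_equiv hm e hb hl, code_rev, List.reverse_reverse]
  · rintro (h | h)
    · exact exists_iso_of_code_eq h.symm
    · obtain ⟨τ, -⟩ := C.exists_iso_rev
      rw [← code_rev] at h
      obtain ⟨ρ⟩ := exists_iso_of_code_eq h.symm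
      exact ⟨τ.trans ρ⟩

lemma weight_code (C : Chain) : weight C.code = Fintype.card C.V := by
  have h : weight C.code = ∑ i ∈ Finset.range (C.m + 1), (C.legs i).weight := by
    rw [weight, code, List.map_map]; rfl
  rw [h, card_V]
  simp only [Legs.weight, Finset.sum_add_distrib, Finset.sum_const, Finset.card_range,
    smul_eq_mul, mul_one]
  rw [add_comm]
  congr 1
  exact Finset.sum_fiberwise_of_maps_to
    (fun a _ => Finset.mem_range.2 (Nat.lt_succ_of_le (C.base_le a))) _

/-- Every nonempty list of partitions is the code of a chain. -/
lemma exists_code_eq (l : List Legs) (hl : l ≠ []) : ∃ C : Chain, C.code = l := by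
  classical
  have hlen : 0 < l.length := List.length_pos_of_ne_nil hl
  let C : Chain :=
    { m := l.length - 1
      A := Σ i : Fin l.length, (l[i].1).ToType
      base := fun a => a.1.1
      len := fun a => a.2.1
      base_le := fun a => by have := a.1.2; omega
      len_pos := fun a => Nat.pos_of_ne_zero fun h => by
        have h1 : a.2.1 ∈ l[a.1].1 := Multiset.coe_mem
        rw [h] at h1
        exact l[a.1].2 h1 }
  refine ⟨C, List.ext_getElem ?_ fun i h1 h2 => ?_⟩
  · rw [length_code]; change l.length - 1 + 1 = _; omega
  · rw [getElem_code]
    refine Subtype.ext ?_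
    have h3 : (Finset.univ.filter fun a : C.A => C.base a = i) =
        Finset.univ.map (Function.Embedding.sigmaMk (⟨i, h2⟩ : Fin l.length)) := by
      ext ⟨j, x⟩
      simp only [Finset.mem_filter, Finset.mem_univ, true_and, Finset.mem_map]
      constructor
      · intro h
        have h4 : (⟨i, h2⟩ : Fin l.length) = j := Fin.ext h.symm
        subst h4
        exact ⟨x, rfl⟩
      · rintro ⟨y, hy⟩
        rw [Sigma.mk.injEq] at hy
        exact (congrArg Fin.val hy.1).symm
    change (Finset.univ.filter fun a : C.A => C.base a = i).val.map C.len = _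
    rw [h3, Finset.map_val, Multiset.map_map]
    exact Multiset.map_univ_coe l[i].1

/-- A chain with a given code. -/
noncomputable def ofCode (l : List Legs) (hl : l ≠ []) : Chain := (exists_code_eq l hl).choose

lemma code_ofCode (l : List Legs) (hl : l ≠ []) : (ofCode l hl).code = l :=
  (exists_code_eq l hl).choose_spec

end Chain

/-! ### Isomorphism classes of linear trees -/

lemma Chain.isLinearTree_of_iso {C : Chain} {W : Type*} [Finite W] {H : SimpleGraph W}
    (σ : C.graph ≃g H) : IsLinearTree H := by
  obtain ⟨par, hpar⟩ := IsRooting.of_isTree (σ.isTree_iff.1 C.isRooting.isTree) (σ C.start)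
  have hσ := C.isRooting.iso_par_lev hpar σ rfl
  refine hpar.isLinearTree (σ C.finish) fun w hw => ?_
  obtain ⟨k, hk⟩ := (C.exists_iterate_finish_iff _).2
    (Chain.exists_inl_of_isHDV (hw.map_iso σ.symm))
  refine ⟨k, ?_⟩
  have hit : ∀ k, par^[k] (σ C.finish) = σ (C.par^[k] C.finish) := by
    intro k
    induction k with
    | zero => rfl
    | succ k ih => rw [Function.iterate_succ_apply', Function.iterate_succ_apply', (hσ _).1, ih]
  rw [hit, hk]
  exact σ.apply_symm_apply w

/-- The codes of the trees on `n` vertices. -/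
abbrev CodesOf (n : ℕ) : Type := {l : List Legs // l ≠ [] ∧ weight l = n}

/-- The linear trees on the vertex set `Fin n`, up to isomorphism. -/
abbrev LinearClass (n : ℕ) : Type := Quotient (isoSetoid n fun G => IsLinearTree G)

lemma card_V_ofCode {n : ℕ} (l : CodesOf n) :
    Fintype.card (Chain.ofCode l.1 l.2.1).V = n := by
  rw [← Chain.weight_code, Chain.code_ofCode, l.2.2]

/-- The isomorphism class of the tree with a given code. -/
noncomputable def codeClass (n : ℕ) (l : CodesOf n) : LinearClass n :=
  Quotient.mk _ ⟨(Chain.ofCode l.1 l.2.1).graph.overFin (card_V_ofCode l),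
    Chain.isLinearTree_of_iso (SimpleGraph.overFinIso _ (card_V_ofCode l))⟩

lemma codeClass_eq_iff {n : ℕ} (l l' : CodesOf n) : codeClass n l = codeClass n l' ↔
    Nonempty ((Chain.ofCode l.1 l.2.1).graph ≃g (Chain.ofCode l'.1 l'.2.1).graph) := by
  rw [codeClass, codeClass, Quotient.eq]
  have σ := (Chain.ofCode l.1 l.2.1).graph.overFinIso (card_V_ofCode l)
  have τ := (Chain.ofCode l'.1 l'.2.1).graph.overFinIso (card_V_ofCode l')
  constructor
  · rintro ⟨ρ⟩
    exact ⟨(σ.trans ρ).trans τ.symm⟩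
  · rintro ⟨ρ⟩
    exact ⟨(σ.symm.trans ρ).trans τ⟩

/-- Partitions into at least two parts, as needed at the ends of the spine. -/
abbrev EndLegs : Type := {π : Legs // 2 ≤ π.1.card}

/-- Lists of partitions of length at least two that begin and end with a partition into at least
two parts, split into the first entry, the inner entries and the last entry. -/
abbrev LongCode : Type := EndLegs × List Legs × EndLegs

namespace LongCode

/-- The list of all entries. -/
def toList (x : LongCode) : List Legs := x.1.1 :: (x.2.1 ++ [x.2.2.1])

/-- The reversed list. -/
def reverse (x : LongCode) : LongCode := (x.2.2, x.2.1.reverse, x.1)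

lemma toList_ne_nil (x : LongCode) : x.toList ≠ [] := List.cons_ne_nil _ _

lemma toList_reverse (x : LongCode) : x.reverse.toList = x.toList.reverse := by
  simp [toList, reverse]

lemma toList_injective : Function.Injective toList := by
  rintro ⟨a, l, b⟩ ⟨a', l', b'⟩ h
  simp only [toList, List.cons.injEq] at h
  obtain ⟨h1, h2⟩ := h
  obtain ⟨h3, h4⟩ := List.append_inj' h2 rfl
  rw [Subtype.ext h1, h3, Subtype.ext (List.singleton_injective h4)]

lemma weight_toList (x : LongCode) :
    weight x.toList = x.1.1.weight + (weight x.2.1 + x.2.2.1.weight) := by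
  simp [toList, weight]

lemma weight_reverse (x : LongCode) : weight x.reverse.toList = weight x.toList := by
  rw [toList_reverse, weight, weight, List.map_reverse, List.sum_reverse]

/-- The ends of the spine of a chain with such a code have high degree. -/
lemma isHDV_ends {C : Chain} {x : LongCode} (h : C.code = x.toList) :
    IsHDV C.graph C.start ∧ IsHDV C.graph C.finish := by
  have hl : C.m + 1 = x.2.1.length + 2 := by
    rw [← C.length_code, h]; simp [toList]
  have hm : C.m ≠ 0 := by omega
  rw [Chain.isHDV_start_iff hm, Chain.isHDV_finish_iff hm, ← C.card_legs, ← C.card_legs,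
    ← C.getElem_code 0 (by rw [C.length_code]; omega),
    ← C.getElem_code C.m (by rw [C.length_code]; omega)]
  constructor
  · have h1 : C.code[0]'(by rw [C.length_code]; omega) = x.1.1 := by
      simp only [h]; rfl
    rw [h1]; exact x.1.2
  · have h1 : C.code[C.m]'(by rw [C.length_code]; omega) = x.2.2.1 := by
      have h2 : C.m = x.2.1.length + 1 := by omega
      simp only [h, h2]
      simp [toList]
    rw [h1]; exact x.2.2.2

/-- A chain whose spine has at least two vertices and ends in vertices of high degree has such a
code. -/
lemma exists_of_isHDV {C : Chain} (hm : C.m ≠ 0) (h1 : IsHDV C.graph C.start)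
    (h2 : IsHDV C.graph C.finish) : ∃ x : LongCode, C.code = x.toList := by
  rw [Chain.isHDV_start_iff hm, ← C.card_legs] at h1
  rw [Chain.isHDV_finish_iff hm, ← C.card_legs] at h2
  refine ⟨(⟨C.legs 0, h1⟩, (List.range (C.m - 1)).map (fun i => C.legs (i + 1)),
    ⟨C.legs C.m, h2⟩), ?_⟩
  obtain ⟨k, hk⟩ := Nat.exists_eq_succ_of_ne_zero hm
  change (List.range (C.m + 1)).map C.legs =
    C.legs 0 :: ((List.range (C.m - 1)).map (fun i => C.legs (i + 1)) ++ [C.legs C.m])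
  rw [hk, List.range_succ, List.map_append, List.range_succ_eq_map]
  simp [List.map_map, Function.comp_def]

end LongCode

/-! ### Counting codes -/

section Weights

variable {α β : Type*} (w : α → ℕ) (v : β → ℕ)

/-- A pair of given total weight is given by a splitting of the weight and two objects of the
respective weights. -/
def weightProdEquiv (n : ℕ) : {p : α × β // w p.1 + v p.2 = n} ≃
    Σ ij : antidiagonal n, {a // w a = ij.1.1} × {b // v b = ij.1.2} where
  toFun p := ⟨⟨(w p.1.1, v p.1.2), mem_antidiagonal.2 p.2⟩, ⟨p.1.1, rfl⟩, ⟨p.1.2, rfl⟩⟩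
  invFun x := ⟨(x.2.1.1, x.2.2.1), by
    rw [x.2.1.2, x.2.2.2]; exact mem_antidiagonal.1 x.1.2⟩
  left_inv _ := rfl
  right_inv := by
    rintro ⟨⟨⟨i, j⟩, h⟩, ⟨a, ha⟩, ⟨b, hb⟩⟩
    obtain rfl : w a = i := ha
    obtain rfl : v b = j := hb
    rfl

variable [∀ i, Finite {a // w a = i}] [∀ i, Finite {b // v b = i}]

instance finite_weight_prod (n : ℕ) : Finite {p : α × β // w p.1 + v p.2 = n} :=
  Finite.of_equiv _ (weightProdEquiv w v n).symm

lemma card_weight_prod (n : ℕ) : Nat.card {p : α × β // w p.1 + v p.2 = n} =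
    ∑ ij ∈ antidiagonal n, Nat.card {a // w a = ij.1} * Nat.card {b // v b = ij.2} := by
  rw [Nat.card_congr (weightProdEquiv w v n), Nat.card_sigma]
  simp only [Nat.card_prod]
  exact Finset.sum_coe_sort (antidiagonal n)
    (fun ij => Nat.card {a // w a = ij.1} * Nat.card {b // v b = ij.2})

end Weights

/-- If the nonempty fibres of a map are the orbits of an involution, its range has about half the
size of its domain, up to the fixed points of the involution. -/
lemma card_range_bounds {X Y : Type*} [Finite X] (q : X → Y) (ρ : X → X)
    (hρ : ∀ x y, q x = q y ↔ y = x ∨ y = ρ x) :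
    Nat.card X ≤ 2 * Nat.card (Set.range q) ∧
      2 * Nat.card (Set.range q) ≤ Nat.card X + Nat.card {x // ρ x = x} := by
  classical
  have := Fintype.ofFinite X
  have hI : Nat.card (Set.range q) = (Finset.univ.image q).card := by
    rw [← Set.image_univ, ← Finset.coe_univ, ← Finset.coe_image]
    exact Set.ncard_coe_finset _
  have h1 : Nat.card X = ∑ y ∈ Finset.univ.image q, (Finset.univ.filter fun x => q x = y).card := by
    rw [Nat.card_eq_fintype_card, ← Finset.card_univ,
      Finset.card_eq_sum_card_image q Finset.univ]
  have h2 : Nat.card {x // ρ x = x} = ∑ y ∈ Finset.univ.image q,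
      ((Finset.univ.filter fun x => ρ x = x).filter fun x => q x = y).card := by
    rw [Nat.card_eq_fintype_card, Fintype.card_subtype]
    exact Finset.card_eq_sum_card_fiberwise fun x _ =>
      Finset.mem_image_of_mem q (Finset.mem_univ x)
  rw [hI, h1, h2, ← Finset.sum_add_distrib, mul_comm, ← smul_eq_mul]
  constructor
  · refine Finset.sum_le_card_nsmul _ _ _ fun y hy => ?_
    obtain ⟨x, -, rfl⟩ := Finset.mem_image.1 hy
    refine le_trans (Finset.card_le_card (t := {x, ρ x}) fun z hz => ?_) Finset.card_le_two
    simp only [Finset.mem_filter, Finset.mem_univ, true_and] at hz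
    simpa using (hρ x z).1 hz.symm
  · refine Finset.card_nsmul_le_sum _ _ _ fun y hy => ?_
    obtain ⟨x, -, rfl⟩ := Finset.mem_image.1 hy
    by_cases hx : ρ x = x
    · have h3 : 0 < (Finset.univ.filter fun z => q z = q x).card :=
        Finset.card_pos.2 ⟨x, by simp⟩
      have h4 : 0 < ((Finset.univ.filter fun z => ρ z = z).filter fun z => q z = q x).card :=
        Finset.card_pos.2 ⟨x, by simp [hx]⟩
      omega
    · have h3 : 1 < (Finset.univ.filter fun z => q z = q x).card := by
        refine Finset.one_lt_card.2 ⟨x, by simp, ρ x, ?_, fun h => hx h.symm⟩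
        simp only [Finset.mem_filter, Finset.mem_univ, true_and]
        exact ((hρ x (ρ x)).2 (Or.inr rfl)).symm
      omega

/-- Partitions of `k` are the leg multisets of spiders with `k + 1` vertices. -/
def legsEquivPartition (k : ℕ) : {π : Legs // π.weight = k + 1} ≃ Nat.Partition k where
  toFun π := ⟨π.1.1, fun h => Nat.pos_of_ne_zero fun h0 => π.1.2 (h0 ▸ h), by
    have := π.2; unfold Legs.weight at this; omega⟩
  invFun p := ⟨⟨p.parts, fun h => (p.parts_pos h).ne' rfl⟩, by
    rw [Legs.weight, p.parts_sum]⟩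
  left_inv _ := rfl
  right_inv _ := rfl

lemma isEmpty_legs_zero : IsEmpty {π : Legs // π.weight = 0} :=
  ⟨fun π => Nat.succ_ne_zero _ π.2⟩

instance finite_legs (n : ℕ) : Finite {π : Legs // π.weight = n} := by
  cases n with
  | zero => have := isEmpty_legs_zero; infer_instance
  | succ k => exact Finite.of_equiv _ (legsEquivPartition k).symm

/-- The number of partitions of `k`. -/
noncomputable def partitionCount (k : ℕ) : ℕ := Nat.card (Nat.Partition k)

lemma card_legs_zero : Nat.card {π : Legs // π.weight = 0} = 0 := by
  have := isEmpty_legs_zero; simp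

lemma card_legs_succ (k : ℕ) : Nat.card {π : Legs // π.weight = k + 1} = partitionCount k :=
  Nat.card_congr (legsEquivPartition k)

instance finite_endLegs (n : ℕ) : Finite {π : EndLegs // π.1.weight = n} :=
  Finite.of_injective (fun π => (⟨π.1.1, π.2⟩ : {π : Legs // π.weight = n})) fun a b h => by
    apply Subtype.ext; apply Subtype.ext
    exact congrArg (fun π => π.1) h

lemma card_endLegs_zero : Nat.card {π : EndLegs // π.1.weight = 0} = 0 := by
  have : IsEmpty {π : EndLegs // π.1.weight = 0} := ⟨fun π => Nat.succ_ne_zero _ π.2⟩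
  simp

/-- Exactly one partition of `k` has fewer than two parts. -/
lemma card_endLegs_succ (k : ℕ) :
    Nat.card {π : EndLegs // π.1.weight = k + 1} + 1 = partitionCount k := by
  rw [← card_legs_succ]
  have h0 : ∃! π : {π : Legs // π.weight = k + 1}, ¬ 2 ≤ π.1.1.card := by
    rcases Nat.eq_zero_or_pos k with rfl | hk
    · refine ⟨⟨⟨0, by simp⟩, by simp [Legs.weight]⟩, by simp, ?_⟩
      rintro ⟨⟨π, h0⟩, hw⟩ hc
      simp only [Legs.weight, Nat.add_eq_right, Multiset.sum_eq_zero_iff] at hw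
      apply Subtype.ext; apply Subtype.ext
      exact Multiset.eq_zero_of_forall_notMem fun a ha => h0 (hw a ha ▸ ha)
    · refine ⟨⟨⟨{k}, by simpa using hk.ne⟩, by simp [Legs.weight]⟩, by simp, ?_⟩
      rintro ⟨⟨π, h0⟩, hw⟩ hc
      simp only [Legs.weight, Nat.add_right_cancel_iff] at hw
      apply Subtype.ext; apply Subtype.ext
      have h1 : π.card = 0 ∨ π.card = 1 := by simp only at hc; omega
      rcases h1 with h1 | h1
      · rw [Multiset.card_eq_zero.1 h1] at hw; simp at hw; omega
      · obtain ⟨a, rfl⟩ := Multiset.card_eq_one.1 h1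
        simp at hw; simp [hw]
  have h1 : Nat.card {π : {π : Legs // π.weight = k + 1} // ¬ 2 ≤ π.1.1.card} = 1 := by
    obtain ⟨π, hπ, hu⟩ := h0
    rw [Nat.card_eq_one_iff_exists]
    exact ⟨⟨π, hπ⟩, fun π' => Subtype.ext (hu _ π'.2)⟩
  have e : {π : EndLegs // π.1.weight = k + 1} ≃
      {π : {π : Legs // π.weight = k + 1} // 2 ≤ π.1.1.card} :=
    { toFun := fun π => ⟨⟨π.1.1, π.2⟩, π.1.2⟩
      invFun := fun π => ⟨⟨π.1.1, π.2⟩, π.1.2⟩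
      left_inv := fun _ => rfl
      right_inv := fun _ => rfl }
  classical
  have h2 : Nat.card {π : {π : Legs // π.weight = k + 1} // 2 ≤ π.1.1.card} +
      Nat.card {π : {π : Legs // π.weight = k + 1} // ¬ 2 ≤ π.1.1.card} =
        Nat.card {π : Legs // π.weight = k + 1} := by
    rw [← Nat.card_sum]
    exact Nat.card_congr (Equiv.sumCompl _)
  rw [Nat.card_congr e, ← h2, h1]

lemma weight_cons (π : Legs) (l : List Legs) : weight (π :: l) = π.weight + weight l := by
  simp [weight]

/-- A nonempty list consists of a head and a tail. -/
def weightConsEquiv (n : ℕ) : {l : List Legs // weight l = n + 1} ≃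
    {p : Legs × List Legs // p.1.weight + weight p.2 = n + 1} where
  toFun l := match l with
    | ⟨[], h⟩ => absurd h (by simp [weight])
    | ⟨π :: l, h⟩ => ⟨(π, l), by rwa [weight_cons] at h⟩
  invFun p := ⟨p.1.1 :: p.1.2, by rw [weight_cons]; exact p.2⟩
  left_inv := by
    rintro ⟨_ | ⟨π, l⟩, h⟩
    · exact absurd h (by simp [weight])
    · rfl
  right_inv _ := rfl

lemma weight_eq_zero_iff (l : List Legs) : weight l = 0 ↔ l = [] := by
  cases l with
  | nil => simp [weight]
  | cons π l => simp [weight_cons, Legs.weight]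

instance finite_lists (n : ℕ) : Finite {l : List Legs // weight l = n} := by
  induction n using Nat.strong_induction_on with
  | _ n ih =>
    cases n with
    | zero =>
      have : Subsingleton {l : List Legs // weight l = 0} := ⟨fun a b => Subtype.ext
        (((weight_eq_zero_iff _).1 a.2).trans ((weight_eq_zero_iff _).1 b.2).symm)⟩
      infer_instance
    | succ n =>
      have : ∀ ij : antidiagonal (n + 1), Finite ({π : Legs // π.weight = ij.1.1} ×
          {l : List Legs // weight l = ij.1.2}) := by
        rintro ⟨⟨i, j⟩, h⟩
        rw [mem_antidiagonal] at h
        simp only at h ⊢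
        rcases Nat.eq_zero_or_pos i with rfl | hi
        · have := isEmpty_legs_zero
          infer_instance
        · have := ih j (by omega)
          infer_instance
      exact Finite.of_equiv _
        ((weightConsEquiv n).trans (weightProdEquiv Legs.weight weight (n + 1))).symm

/-- The number of lists of partitions of total weight `n`. -/
noncomputable def listCount (n : ℕ) : ℕ := Nat.card {l : List Legs // weight l = n}

lemma listCount_zero : listCount 0 = 1 := by
  rw [listCount, Nat.card_eq_one_iff_exists]
  exact ⟨⟨[], rfl⟩, fun l => Subtype.ext ((weight_eq_zero_iff _).1 l.2)⟩

/-- The renewal equation for the numbers of lists of partitions. -/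
lemma listCount_succ (n : ℕ) : listCount (n + 1) =
    ∑ ij ∈ antidiagonal n, partitionCount ij.1 * listCount ij.2 := by
  rw [listCount, Nat.card_congr (weightConsEquiv n), card_weight_prod Legs.weight weight,
    Finset.Nat.sum_antidiagonal_succ, card_legs_zero, zero_mul, zero_add]
  simp only [card_legs_succ]
  rfl

/-- The number of partitions with at least two parts and weight `n`. -/
noncomputable def endCount (n : ℕ) : ℕ := Nat.card {π : EndLegs // π.1.weight = n}

/-- The number of codes of weight `n` with ends of high degree. -/
noncomputable def longCount (n : ℕ) : ℕ := Nat.card {x : LongCode // weight x.toList = n}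

lemma weight_longCode_eq (n : ℕ) : {x : LongCode // weight x.toList = n} =
    {x : LongCode // x.1.1.weight + (weight x.2.1 + x.2.2.1.weight) = n} := by
  simp only [LongCode.weight_toList]

instance finite_listEnd (n : ℕ) :
    Finite {p : List Legs × EndLegs // weight p.1 + p.2.1.weight = n} :=
  finite_weight_prod weight (fun π : EndLegs => π.1.weight) n

instance finite_longCode (n : ℕ) : Finite {x : LongCode // weight x.toList = n} := by
  rw [weight_longCode_eq]
  exact finite_weight_prod (fun π : EndLegs => π.1.weight)
    (fun p : List Legs × EndLegs => weight p.1 + p.2.1.weight) n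

lemma longCount_eq (n : ℕ) : longCount n = ∑ ij ∈ antidiagonal n,
    endCount ij.1 * ∑ kl ∈ antidiagonal ij.2, listCount kl.1 * endCount kl.2 := by
  rw [longCount, weight_longCode_eq]
  refine (card_weight_prod (fun π : EndLegs => π.1.weight)
    (fun p : List Legs × EndLegs => weight p.1 + p.2.1.weight) n).trans ?_
  refine Finset.sum_congr rfl fun ij _ => ?_
  rw [card_weight_prod weight (fun π : EndLegs => π.1.weight)]
  rfl

/-- The number of palindromic codes of weight `n` with ends of high degree. -/
noncomputable def palindromeCount (n : ℕ) : ℕ :=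
  Nat.card {x : {x : LongCode // weight x.toList = n} // x.1.reverse = x.1}

/-- The weight of a partition that may be absent. -/
def optWeight (o : Option Legs) : ℕ := o.elim 0 Legs.weight

instance finite_optWeight (n : ℕ) : Finite {o : Option Legs // optWeight o = n} := by
  have : {o : Option Legs | optWeight o = n} ⊆
      insert none (some '' {π : Legs | π.weight = n}) := by
    rintro (_ | π) h
    · exact Set.mem_insert _ _
    · exact Set.mem_insert_of_mem _ ⟨π, h, rfl⟩
  refine Set.Finite.subset (Set.Finite.insert _ (Set.Finite.image _ ?_)) this
  exact finite_legs n

lemma card_optWeight_le (n : ℕ) : Nat.card {o : Option Legs // optWeight o = n} ≤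
    Nat.card {π : Legs // π.weight = n} + 1 := by
  rw [← Finite.card_option]
  refine Nat.card_le_card_of_injective (fun o => match o with
    | ⟨none, _⟩ => none
    | ⟨some π, h⟩ => some ⟨π, h⟩) ?_
  rintro ⟨_ | π, h⟩ ⟨_ | π', h'⟩ heq
  · rfl
  · simp at heq
  · simp at heq
  · have h3 : π = π' := congrArg (fun x => x.1) (Option.some_injective _ heq)
    subst h3; rfl

instance finite_doubleWeight (n : ℕ) : Finite {l : List Legs // 2 * weight l = n} :=
  Finite.of_injective (fun l => (⟨l.1, by have := l.2; omega⟩ :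
    {l : List Legs // weight l = n / 2})) fun a b h =>
      Subtype.ext (congrArg (fun l => l.1) h)

/-- A palindrome is determined by its first half and its middle entry, if there is one. -/
lemma palindromeCount_le (n : ℕ) : palindromeCount n ≤ ∑ ij ∈ antidiagonal n,
    Nat.card {l : List Legs // 2 * weight l = ij.1} *
      (Nat.card {π : Legs // π.weight = ij.2} + 1) := by
  have hpal : ∀ l : List Legs, l.reverse = l → ∃ (h : List Legs) (o : Option Legs),
      l = h ++ (o.toList ++ h.reverse) := by
    intro l hl
    have hl' : l.Palindrome := List.Palindrome.of_reverse_eq hl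
    induction hl' with
    | nil => exact ⟨[], none, rfl⟩
    | singleton x => exact ⟨[], some x, rfl⟩
    | @cons_concat x l hp ih =>
      obtain ⟨h, o, rfl⟩ := ih hp.reverse_eq
      exact ⟨x :: h, o, by simp⟩
  choose H hH using hpal
  choose O hO using hH
  have hrev : ∀ x : {x : {x : LongCode // weight x.toList = n} // x.1.reverse = x.1},
      x.1.1.toList.reverse = x.1.1.toList := fun x => by
    rw [← LongCode.toList_reverse, x.2]
  have key : palindromeCount n ≤
      Nat.card {p : List Legs × Option Legs // 2 * weight p.1 + optWeight p.2 = n} := by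
    have := finite_weight_prod (fun l : List Legs => 2 * weight l) optWeight n
    refine Nat.card_le_card_of_injective (fun x => ⟨(H _ (hrev x), O _ (hrev x)), ?_⟩) ?_
    · have h1 := hO _ (hrev x)
      have h2 := x.1.2
      rw [h1] at h2
      simp only
      generalize H _ (hrev x) = h at h2
      generalize O _ (hrev x) = o at h2
      rw [← h2]
      have h3 : weight h.reverse = weight h := by
        rw [weight, weight, List.map_reverse, List.sum_reverse]
      have h4 : weight (h ++ (o.toList ++ h.reverse)) =
          weight h + (optWeight o + weight h.reverse) := by
        rw [weight, List.map_append, List.map_append, List.sum_append, List.sum_append]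
        cases o <;> simp [optWeight, weight]
      omega
    · intro x y hxy
      simp only [Subtype.mk.injEq, Prod.mk.injEq] at hxy
      have h1 := hO _ (hrev x)
      have h2 := hO _ (hrev y)
      rw [hxy.1, hxy.2, ← h2] at h1
      exact Subtype.ext (Subtype.ext (LongCode.toList_injective h1))
  refine key.trans ?_
  rw [card_weight_prod (fun l : List Legs => 2 * weight l) optWeight]
  exact Finset.sum_le_sum fun ij _ => Nat.mul_le_mul_left _ (card_optWeight_le _)

/-- Up to the palindromes and the trees with at most one vertex of high degree, every linear tree
has exactly two codes. -/
theorem two_mul_linearTreeCount_bounds (n : ℕ) : longCount n ≤ 2 * linearTreeCount n ∧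
    2 * linearTreeCount n ≤
      longCount n + palindromeCount n + 2 * Nat.card {π : Legs // π.weight = n} := by
  let q : {x : LongCode // weight x.toList = n} → LinearClass n := fun x =>
    codeClass n ⟨x.1.toList, x.1.toList_ne_nil, x.2⟩
  let ρ : {x : LongCode // weight x.toList = n} → {x : LongCode // weight x.toList = n} :=
    fun x => ⟨x.1.reverse, by rw [LongCode.weight_reverse]; exact x.2⟩
  have hρ : ∀ x y, q x = q y ↔ y = x ∨ y = ρ x := by
    intro x y
    have hx := LongCode.isHDV_ends (Chain.code_ofCode x.1.toList x.1.toList_ne_nil)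
    have hy := LongCode.isHDV_ends (Chain.code_ofCode y.1.toList y.1.toList_ne_nil)
    rw [codeClass_eq_iff, Chain.nonempty_iso_iff hx.1 hx.2 hy.1 hy.2, Chain.code_ofCode,
      Chain.code_ofCode, ← LongCode.toList_reverse, LongCode.toList_injective.eq_iff,
      LongCode.toList_injective.eq_iff, Subtype.ext_iff, Subtype.ext_iff]
  obtain ⟨h1, h2⟩ := card_range_bounds q ρ hρ
  have h3 : Nat.card {x // ρ x = x} = palindromeCount n :=
    Nat.card_congr (Equiv.subtypeEquivRight fun x => Subtype.ext_iff)
  rw [h3] at h2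
  let q' : {π : Legs // π.weight = n} → LinearClass n := fun π =>
    codeClass n ⟨[π.1], List.cons_ne_nil _ _, by simpa [weight] using π.2⟩
  -- a spine with one vertex gives a code of length one, and a longer spine a long code
  have hcover : Set.range q ∪ Set.range q' = Set.univ := by
    refine Set.eq_univ_of_forall fun c => ?_
    induction c using Quotient.inductionOn with
    | _ G =>
      obtain ⟨C, ⟨σ⟩, hC⟩ := G.2.exists_chain
      have hw : weight C.code = n := by
        rw [C.weight_code, Fintype.card_congr σ.toEquiv, Fintype.card_fin]
      have hcls : ∀ l : CodesOf n, C.code = l.1 → codeClass n l = Quotient.mk _ G := by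
        intro l hl
        rw [codeClass, Quotient.eq]
        obtain ⟨τ⟩ := Chain.exists_iso_of_code_eq
          ((Chain.code_ofCode l.1 l.2.1).trans hl.symm)
        exact ⟨(((Chain.ofCode l.1 l.2.1).graph.overFinIso (card_V_ofCode l)).symm.trans
          τ).trans σ⟩
      by_cases hm : C.m = 0
      · right
        have hc : C.code = [C.legs 0] := by simp [Chain.code, hm]
        refine ⟨⟨C.legs 0, ?_⟩, hcls _ hc⟩
        rw [hc] at hw
        simpa [weight] using hw
      · left
        obtain ⟨h5, h6⟩ := hC.resolve_left hm
        obtain ⟨x, hx⟩ := LongCode.exists_of_isHDV hm h5 h6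
        exact ⟨⟨x, hx ▸ hw⟩, hcls _ hx⟩
  have h4 : linearTreeCount n ≤
      Nat.card (Set.range q) + Nat.card {π : Legs // π.weight = n} := by
    change Nat.card (LinearClass n) ≤ _
    rw [← Nat.card_univ, ← hcover]
    refine (Set.ncard_union_le _ _).trans (Nat.add_le_add_left ?_ _)
    exact Nat.card_le_card_of_surjective _ (Set.rangeFactorization_surjective (f := q'))
  have : Finite (LinearClass n) := by
    unfold LinearClass; infer_instance
  have h5 : Nat.card (Set.range q) ≤ linearTreeCount n :=
    Nat.card_le_card_of_injective _ Subtype.val_injective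
  rw [longCount]
  omega

/-! ### A lower bound for the number of trees -/

section LevelTrees

variable {r h l : ℕ}

/-- The vertices of the level trees: a path with `r + 1` vertices, followed by `h + 1` levels of
`l` vertices each. -/
abbrev LevelVertex (r h l : ℕ) : Type := Fin (r + 1) ⊕ (Fin (h + 1) × Fin l)

/-- The parent map of the level tree given by `φ`, which chooses for each vertex below the first
wide level a parent in the level before. -/
def levelPar (φ : Fin h × Fin l → Fin l) : LevelVertex r h l → LevelVertex r h l
  | .inl i => .inl ⟨i.1 - 1, by omega⟩
  | .inr (i, j) => Fin.cases (.inl (Fin.last r)) (fun i => .inr (i.castSucc, φ (i, j))) i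

/-- The level of a vertex in a level tree. -/
def level : LevelVertex r h l → ℕ
  | .inl i => i.1
  | .inr (i, _) => r + 1 + i.1

/-- The level tree given by a choice of parents. -/
def levelTree (r : ℕ) (φ : Fin h × Fin l → Fin l) : SimpleGraph (LevelVertex r h l) :=
  parentGraph (.inl 0) (levelPar φ)

lemma isRooting_levelTree (φ : Fin h × Fin l → Fin l) :
    IsRooting (levelTree r φ) (.inl 0) (levelPar φ) level := by
  refine isRooting_parentGraph rfl rfl ?_
  rintro (i | ⟨i, j⟩) hv
  · have : i.1 ≠ 0 := fun h => hv (by rw [Sum.inl.injEq]; exact Fin.ext h)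
    simp only [levelPar, level]; omega
  · induction i using Fin.cases with
    | zero => simp [levelPar, level]
    | succ i => simp [levelPar, level]; omega

/-- An isomorphism of level trees that preserves the root permutes each level, and these
permutations turn one choice of parents into the other. -/
lemma exists_perm_of_iso {φ ψ : Fin h × Fin l → Fin l} (τ : levelTree r φ ≃g levelTree r ψ)
    (hτ : τ (.inl 0) = .inl 0) : ∃ π : Fin (h + 1) → Equiv.Perm (Fin l),
      φ = fun p => (π p.1.castSucc).symm (ψ (p.1, π p.1.succ p.2)) := by
  have hpl := (isRooting_levelTree φ).iso_par_lev (isRooting_levelTree ψ) τ hτ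
  have hex : ∀ i j, ∃ k, τ (.inr (i, j)) = .inr (i, k) := by
    intro i j
    have h1 := (hpl (.inr (i, j))).2
    rcases hv : τ (.inr (i, j)) with i' | ⟨i', k⟩
    · rw [hv] at h1
      simp only [level] at h1
      omega
    · rw [hv] at h1
      simp only [level] at h1
      have : i' = i := Fin.ext (by omega)
      exact ⟨k, by rw [this]⟩
  choose f hf using hex
  have hinj : ∀ i, Function.Injective (f i) := by
    intro i j j' hjj
    have h1 : τ (.inr (i, j)) = τ (.inr (i, j')) := by rw [hf, hf, hjj]
    simpa using τ.injective h1
  refine ⟨fun i => Equiv.ofBijective (f i) (Finite.injective_iff_bijective.1 (hinj i)), ?_⟩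
  funext ⟨i, j⟩
  rw [Equiv.eq_symm_apply]
  have h1 := (hpl (.inr (i.succ, j))).1
  rw [hf] at h1
  simp only [levelPar, Fin.cases_succ] at h1
  rw [hf] at h1
  simpa using h1

/-- There are `l ^ (h * l)` level trees. Those in one isomorphism class whose root corresponds to
the same vertex of a representative differ by permutations of the `h + 1` wide levels, and there are as
many choices of that vertex as vertices. -/
theorem pow_le_treeCount (r h l : ℕ) : l ^ (h * l) ≤
    l.factorial ^ (h + 1) *
      (treeCount (r + 1 + (h + 1) * l) * (r + 1 + (h + 1) * l)) := by
  classical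
  set n := r + 1 + (h + 1) * l with hn
  have hcard : Fintype.card (LevelVertex r h l) = n := by simp [hn]
  let c : (Fin h × Fin l → Fin l) → Quotient (isoSetoid n fun G => G.IsTree) := fun φ =>
    Quotient.mk _ ⟨(levelTree r φ).overFin hcard,
      ((levelTree r φ).overFinIso hcard).isTree_iff.1 (isRooting_levelTree φ).isTree⟩
  have hσ : ∀ φ, Nonempty (levelTree r φ ≃g (c φ).out.1) := by
    intro φ
    obtain ⟨σ⟩ := Quotient.exact (Quotient.out_eq (c φ))
    exact ⟨((levelTree r φ).overFinIso hcard).trans σ.symm⟩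
  have := Fintype.ofFinite (Quotient (isoSetoid n fun G => G.IsTree))
  -- the isomorphism class, and the position of the root in its representative
  let F : (Fin h × Fin l → Fin l) → Quotient (isoSetoid n fun G => G.IsTree) × Fin n :=
    fun φ => (c φ, (hσ φ).some (.inl 0))
  have h1 := Finset.card_le_mul_card_image (f := F) Finset.univ (l.factorial ^ (h + 1)) ?_
  · have h2 : (Finset.univ.image F).card ≤ treeCount n * n := by
      refine (Finset.card_le_univ _).trans_eq ?_
      rw [Fintype.card_prod, Fintype.card_fin, treeCount, isoClassCount,
        Nat.card_eq_fintype_card]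
    have h3 : (Finset.univ : Finset (Fin h × Fin l → Fin l)).card = l ^ (h * l) := by
      simp
    rw [← h3]
    exact h1.trans (Nat.mul_le_mul_left _ h2)
  · intro x hx
    obtain ⟨ψ, -, rfl⟩ := Finset.mem_image.1 hx
    have h4 : (Finset.univ.filter fun φ => F φ = F ψ) ⊆
        (Finset.univ : Finset (Fin (h + 1) → Equiv.Perm (Fin l))).image
          fun π p => (π p.1.castSucc).symm (ψ (p.1, π p.1.succ p.2)) := by
      intro φ hφ
      simp only [Finset.mem_filter, Finset.mem_univ, true_and, F, Prod.mk.injEq] at hφ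
      obtain ⟨h5, h6⟩ := hφ
      -- stated for all `q` equal to the class of `ψ`, since the type of `ρ` depends on the class
      have key : ∀ q, q = c ψ → ∀ ρ : levelTree r φ ≃g q.out.1,
          ρ (.inl 0) = (hσ ψ).some (.inl 0) →
          ∃ τ : levelTree r φ ≃g levelTree r ψ, τ (.inl 0) = .inl 0 := by
        rintro q rfl ρ hρ
        refine ⟨ρ.trans (hσ ψ).some.symm, ?_⟩
        change (hσ ψ).some.symm (ρ (.inl 0)) = _
        rw [hρ]
        exact (hσ ψ).some.symm_apply_apply _
      obtain ⟨τ, hτ⟩ := key (c φ) h5 (hσ φ).some h6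
      obtain ⟨π, hπ⟩ := exists_perm_of_iso τ hτ
      exact Finset.mem_image.2 ⟨π, Finset.mem_univ _, hπ.symm⟩
    refine (Finset.card_le_card h4).trans (Finset.card_image_le.trans_eq ?_)
    simp [Fintype.card_perm]

end LevelTrees

/-! ### The renewal theorem -/

/-- Limits of convolutions along a filter `F ≤ atTop` may be taken term by term. -/
lemma tendsto_convolution_shift {F : Filter ℕ} (hF : F ≤ atTop) {c v w : ℕ → ℝ} {B : ℝ}
    (hc0 : ∀ n, 0 ≤ c n) (hc : Summable c) (hB : ∀ n, ‖v n‖ ≤ B)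
    (hw : ∀ k, Tendsto (fun n => v (n - k)) F (𝓝 (w k))) :
    Tendsto (fun n => ∑ ij ∈ antidiagonal n, c ij.1 * v ij.2) F (𝓝 (∑' k, c k * w k)) := by
  have hB0 : 0 ≤ B := (norm_nonneg _).trans (hB 0)
  have h1 : (fun n => ∑ ij ∈ antidiagonal n, c ij.1 * v ij.2) =
      fun n => ∑' k, (if k ≤ n then c k * v (n - k) else 0) := by
    funext n
    rw [Finset.Nat.sum_antidiagonal_eq_sum_range_succ (fun i j => c i * v j),
      tsum_eq_sum (s := Finset.range (n + 1)) (fun k hk => by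
        rw [if_neg]; rw [Finset.mem_range] at hk; omega)]
    refine Finset.sum_congr rfl fun k hk => ?_
    rw [if_pos]; rw [Finset.mem_range] at hk; omega
  rw [h1]
  refine tendsto_tsum_of_dominated_convergence (bound := fun k => c k * B)
    (hc.mul_right B) (fun k => ?_) (Eventually.of_forall fun n k => ?_)
  · refine ((hw k).const_mul (c k)).congr' ?_
    filter_upwards [hF (eventually_ge_atTop k)] with n hn
    rw [if_pos hn]
  · split_ifs
    · rw [norm_mul, Real.norm_of_nonneg (hc0 k)]
      exact mul_le_mul_of_nonneg_left (hB _) (hc0 k)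
    · rw [norm_zero]; exact mul_nonneg (hc0 k) hB0

/-- Convolution with a summable sequence multiplies the limit of a convergent sequence by the sum
of the summable one. -/
lemma tendsto_convolution {c v : ℕ → ℝ} {s L : ℝ} (hc0 : ∀ n, 0 ≤ c n) (hc : HasSum c s)
    (hv : Tendsto v atTop (𝓝 L)) :
    Tendsto (fun n => ∑ ij ∈ antidiagonal n, c ij.1 * v ij.2) atTop (𝓝 (s * L)) := by
  obtain ⟨B, hB⟩ := hv.norm.bddAbove_range
  have h := tendsto_convolution_shift le_rfl hc0 hc.summable (fun n => hB ⟨n, rfl⟩)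
    (fun k => hv.comp (tendsto_sub_atTop_nat k))
  rwa [tsum_mul_right, hc.tsum_eq] at h

section Renewal

variable {f v : ℕ → ℝ} {μ : ℝ}

lemma renewal_mem_Icc (hf0 : ∀ k, 0 ≤ f k) (hf : HasSum f 1) (hv0 : v 0 = 1)
    (hv : ∀ n, v (n + 1) = ∑ ij ∈ antidiagonal n, f ij.1 * v ij.2) (n : ℕ) :
    v n ∈ Set.Icc (0 : ℝ) 1 := by
  induction n using Nat.strong_induction_on with
  | _ n ih =>
    cases n with
    | zero => rw [hv0]; exact ⟨zero_le_one, le_rfl⟩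
    | succ n =>
      rw [hv]
      have hj : ∀ ij ∈ antidiagonal n, v ij.2 ∈ Set.Icc (0 : ℝ) 1 := by
        intro ij hij
        rw [mem_antidiagonal] at hij
        exact ih _ (by omega)
      refine ⟨Finset.sum_nonneg fun ij hij => mul_nonneg (hf0 _) (hj ij hij).1, ?_⟩
      calc ∑ ij ∈ antidiagonal n, f ij.1 * v ij.2
          ≤ ∑ ij ∈ antidiagonal n, f ij.1 := Finset.sum_le_sum fun ij hij =>
            mul_le_of_le_one_right (hf0 _) (hj ij hij).2
        _ = ∑ k ∈ Finset.range (n + 1), f k :=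
            Finset.Nat.sum_antidiagonal_eq_sum_range_succ (fun i _ => f i) n
        _ ≤ 1 := sum_le_hasSum _ (fun k _ => hf0 k) hf

/-- The tail `r k = ∑ f j` over `j ≥ k` satisfies `∑ r i * v j = 1` over `i + j = n`. -/
lemma renewal_tail_identity (hv0 : v 0 = 1)
    (hv : ∀ n, v (n + 1) = ∑ ij ∈ antidiagonal n, f ij.1 * v ij.2) (n : ℕ) :
    ∑ ij ∈ antidiagonal n, (1 - ∑ k ∈ Finset.range ij.1, f k) * v ij.2 = 1 := by
  induction n with
  | zero => simp [hv0]
  | succ n ih =>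
    rw [Finset.Nat.sum_antidiagonal_succ]
    simp only [Finset.range_zero, Finset.sum_empty, sub_zero, one_mul, Finset.sum_range_succ]
    rw [hv, ← Finset.sum_add_distrib]
    refine Eq.trans ?_ ih
    refine Finset.sum_congr rfl fun ij _ => ?_
    ring

/-- The tails of a distribution sum up to its mean. -/
lemma hasSum_renewal_tail (hf0 : ∀ k, 0 ≤ f k) (hf : HasSum f 1)
    (hμ : HasSum (fun k : ℕ => ((k : ℝ) + 1) * f k) μ) :
    HasSum (fun k => 1 - ∑ i ∈ Finset.range k, f i) μ := by
  have hr0 : ∀ N, 0 ≤ 1 - ∑ i ∈ Finset.range N, f i := fun N =>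
    sub_nonneg.2 (sum_le_hasSum _ (fun k _ => hf0 k) hf)
  rw [hasSum_iff_tendsto_nat_of_nonneg hr0]
  have hid : ∀ N : ℕ, ∑ k ∈ Finset.range N, (1 - ∑ i ∈ Finset.range k, f i) =
      ∑ j ∈ Finset.range N, ((j : ℝ) + 1) * f j + N * (1 - ∑ i ∈ Finset.range N, f i) := by
    intro N
    induction N with
    | zero => simp
    | succ N ih =>
      rw [Finset.sum_range_succ, ih, Finset.sum_range_succ _ N, Finset.sum_range_succ _ N]
      push_cast
      ring
  have hS := hμ.tendsto_sum_nat
  have h0 : Tendsto (fun N : ℕ => (N : ℝ) * (1 - ∑ i ∈ Finset.range N, f i)) atTop (𝓝 0) := by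
    have h1 : Tendsto (fun N => μ - ∑ j ∈ Finset.range N, ((j : ℝ) + 1) * f j) atTop (𝓝 0) := by
      simpa using hS.const_sub μ
    refine squeeze_zero (fun N => mul_nonneg (Nat.cast_nonneg _) (hr0 N)) (fun N => ?_) h1
    have h2 := ((hasSum_nat_add_iff' N).2 hf).mul_left (N : ℝ)
    have h3 := (hasSum_nat_add_iff' N).2 hμ
    refine hasSum_le (fun j => ?_) h2 h3
    refine mul_le_mul_of_nonneg_right ?_ (hf0 _)
    push_cast
    have : (0 : ℝ) ≤ j := Nat.cast_nonneg j
    linarith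
  simpa only [hid, add_zero] using hS.add h0

/-- An extremal limit point of a renewal sequence is the reciprocal of the mean: the limits of the
shifted sequences along the same ultrafilter are limit points as well and average to the extremal
one, so that they all coincide with it. -/
lemma renewal_extremal (hf0 : ∀ k, 0 ≤ f k) (hf : HasSum f 1) (hpos : 0 < f 0)
    (hμ : HasSum (fun k : ℕ => ((k : ℝ) + 1) * f k) μ) (hv0 : v 0 = 1)
    (hv : ∀ n, v (n + 1) = ∑ ij ∈ antidiagonal n, f ij.1 * v ij.2)
    {L : ℝ} (hL : MapClusterPt L atTop v) {s : ℝ} (hs : s ≠ 0)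
    (hext : ∀ x, MapClusterPt x atTop v → 0 ≤ s * (L - x)) : L = μ⁻¹ := by
  have hmem := renewal_mem_Icc hf0 hf hv0 hv
  have hB : ∀ n, ‖v n‖ ≤ 1 := fun n => by
    rw [Real.norm_of_nonneg (hmem n).1]; exact (hmem n).2
  obtain ⟨U, hU, hUL⟩ := mapClusterPt_iff_ultrafilter.1 hL
  have hshift : ∀ k, Tendsto (fun n : ℕ => n - k) U atTop := fun k =>
    (tendsto_sub_atTop_nat k).mono_left hU
  have hex : ∀ k, ∃ x, Tendsto (fun n => v (n - k)) U (𝓝 x) := by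
    intro k
    obtain ⟨x, -, hx⟩ := isCompact_Icc.ultrafilter_le_nhds
      (U.map fun n => v (n - k)) (by
        rw [le_principal_iff]
        exact mem_map.2 (univ_mem' fun n => hmem (n - k)))
    exact ⟨x, hx⟩
  choose w hw using hex
  have hw0 : w 0 = L := tendsto_nhds_unique (hw 0) hUL
  have hcl : ∀ k, MapClusterPt (w k) atTop v := fun k =>
    mapClusterPt_iff_ultrafilter.2 ⟨U.map fun n => n - k, hshift k, hw k⟩
  have hwB : ∀ k, ‖w k‖ ≤ 1 := fun k =>
    le_of_tendsto (hw k).norm (Eventually.of_forall fun n => hB _)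
  -- the recursion passes to the limit, where it has no initial segment
  have hrec : ∀ j, w j = ∑' k, f k * w (j + 1 + k) := by
    intro j
    have h1 := tendsto_convolution_shift (F := map (fun n => n - (j + 1)) U) (hshift (j + 1)) hf0
      hf.summable hB (w := fun k => w (j + 1 + k)) (fun k => by
        rw [tendsto_map'_iff]
        refine (hw (j + 1 + k)).congr fun n => ?_
        simp only [Function.comp_apply, Nat.sub_sub])
    rw [tendsto_map'_iff] at h1
    refine tendsto_nhds_unique (hw j) (h1.congr' ?_)
    filter_upwards [hU (eventually_ge_atTop (j + 1))] with n hn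
    have h2 : n - j = n - (j + 1) + 1 := by omega
    rw [h2, hv]
    rfl
  have hsum : ∀ j, Summable fun k => f k * w (j + 1 + k) := fun j =>
    Summable.of_norm_bounded hf.summable fun k => by
      rw [norm_mul, Real.norm_of_nonneg (hf0 k)]
      exact mul_le_of_le_one_right (hf0 k) (hwB _)
  have hwL : ∀ j, w j = L := by
    intro j
    induction j with
    | zero => exact hw0
    | succ j ih =>
      have h1 : HasSum (fun k => s * (f k * L - f k * w (j + 1 + k))) 0 := by
        have h2 := ((hf.mul_right L).sub (hsum j).hasSum).mul_left s
        rwa [← hrec j, ih, one_mul, sub_self, mul_zero] at h2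
      have h3 : ∀ k, 0 ≤ s * (f k * L - f k * w (j + 1 + k)) := fun k => by
        have := mul_nonneg (hf0 k) (hext _ (hcl (j + 1 + k)))
        linarith
      have h4 := (hasSum_zero_iff_of_nonneg h3).1 h1
      -- only the gap `1` is needed, since it leads from `j` to `j + 1`
      have h5 : s * (f 0 * L - f 0 * w (j + 1 + 0)) = 0 := congrFun h4 0
      have h6 := (mul_eq_zero.1 h5).resolve_left hs
      rw [← mul_sub] at h6
      have h7 := (mul_eq_zero.1 h6).resolve_left hpos.ne'
      rw [add_zero] at h7
      linarith
  have hr0 : ∀ N, 0 ≤ 1 - ∑ i ∈ Finset.range N, f i := fun N =>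
    sub_nonneg.2 (sum_le_hasSum _ (fun k _ => hf0 k) hf)
  have htail := hasSum_renewal_tail hf0 hf hμ
  -- the limit of the tail identity reads `μ * L = 1`
  have h1 := tendsto_convolution_shift hU hr0 htail.summable hB hw
  simp only [renewal_tail_identity hv0 hv, hwL] at h1
  rw [tsum_mul_right, htail.tsum_eq] at h1
  have h2 : 1 = μ * L := tendsto_nhds_unique tendsto_const_nhds h1
  exact eq_inv_of_mul_eq_one_right h2.symm

/-- **Renewal theorem** of Erdős, Feller and Pollard, for a gap distribution `f` that charges the
gap `1` (the gap `k + 1` has probability `f k`) and has finite mean `μ`. -/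
theorem renewal_theorem (hf0 : ∀ k, 0 ≤ f k) (hf : HasSum f 1) (hpos : 0 < f 0)
    (hμ : HasSum (fun k : ℕ => ((k : ℝ) + 1) * f k) μ) (hv0 : v 0 = 1)
    (hv : ∀ n, v (n + 1) = ∑ ij ∈ antidiagonal n, f ij.1 * v ij.2) :
    Tendsto v atTop (𝓝 μ⁻¹) := by
  have hmem := renewal_mem_Icc hf0 hf hv0 hv
  have hsub : {x | MapClusterPt x atTop v} ⊆ Set.Icc 0 1 := fun x hx =>
    isClosed_Icc.mem_of_mapClusterPt hx (Eventually.of_forall hmem)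
  have hcomp : IsCompact {x | MapClusterPt x atTop v} :=
    isCompact_Icc.of_isClosed_subset isClosed_setOfPred_clusterPt hsub
  obtain ⟨x, -, hx⟩ := isCompact_Icc.exists_mapClusterPt_of_frequently (f := v) (l := atTop)
    (Eventually.of_forall hmem).frequently
  -- both extremal limit points equal `μ⁻¹`
  obtain ⟨M, hM, hMax⟩ := hcomp.exists_isGreatest ⟨x, hx⟩
  obtain ⟨m, hm, hMin⟩ := hcomp.exists_isLeast ⟨x, hx⟩
  have hM' := renewal_extremal hf0 hf hpos hμ hv0 hv hM (s := 1) one_ne_zero fun y hy => by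
    have := hMax hy
    linarith
  have hm' := renewal_extremal hf0 hf hpos hμ hv0 hv hm (s := -1) (by norm_num) fun y hy => by
    have := hMin hy
    linarith
  refine isCompact_Icc.tendsto_nhds_of_unique_mapClusterPt (Eventually.of_forall hmem)
    fun y _ hy => le_antisymm ?_ ?_
  · rw [← hM']; exact hMax hy
  · rw [← hm']; exact hMin hy

end Renewal

/-! ### The partition generating function -/

section PowerSeries

open scoped PowerSeries.WithPiTopology

/-- The formal geometric series in `X ^ (i + 1)`. -/
noncomputable def geomSeries (i : ℕ) : PowerSeries ℝ :=
  PowerSeries.mk fun n => if (i + 1) ∣ n then 1 else 0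

lemma tsum_X_pow_eq_geomSeries (i : ℕ) :
    ∑' j : ℕ, (PowerSeries.X : PowerSeries ℝ) ^ ((i + 1) * j) = geomSeries i := by
  refine HasSum.tsum_eq ?_
  rw [PowerSeries.WithPiTopology.hasSum_iff_hasSum_coeff]
  intro d
  simp only [PowerSeries.coeff_X_pow, geomSeries, PowerSeries.coeff_mk]
  split_ifs with h
  · obtain ⟨c, rfl⟩ := h
    have h := hasSum_single c (f := fun j => if (i + 1) * c = (i + 1) * j then (1 : ℝ) else 0)
      (fun j hj => if_neg fun h => hj (Nat.eq_of_mul_eq_mul_left (Nat.succ_pos i) h).symm)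
    rw [if_pos rfl] at h
    exact h
  · have h0 : (fun j => if d = (i + 1) * j then (1 : ℝ) else 0) = fun _ => 0 := by
      funext j
      rw [if_neg]
      rintro rfl
      exact h ⟨j, rfl⟩
    rw [h0]
    exact hasSum_zero

/-- The coefficients of the finite products tend to the numbers of partitions. -/
lemma tendsto_coeff_prod_geomSeries (k : ℕ) :
    Tendsto (fun N => (∏ i ∈ Finset.range N, geomSeries i).coeff k) atTop
      (𝓝 (partitionCount k : ℝ)) := by
  have h := (Nat.Partition.hasProd_powerSeriesMk_card_restricted ℝ fun _ => True).tendsto_prod_nat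
  simp only [if_true, tsum_X_pow_eq_geomSeries] at h
  have h1 := ((PowerSeries.WithPiTopology.continuous_coeff ℝ k).tendsto _).comp h
  simpa [Nat.Partition.restricted, partitionCount, Nat.card_eq_fintype_card, Function.comp_def]
    using h1

end PowerSeries

lemma coeff_geomSeries (i n : ℕ) :
    (geomSeries i).coeff n = if (i + 1) ∣ n then 1 else 0 := PowerSeries.coeff_mk _ _

lemma coeff_prod_geomSeries_nonneg (N k : ℕ) :
    0 ≤ (∏ i ∈ Finset.range N, geomSeries i).coeff k := by
  induction N generalizing k with
  | zero => simp only [Finset.range_zero, Finset.prod_empty, PowerSeries.coeff_one]; positivity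
  | succ N ih =>
    rw [Finset.prod_range_succ, PowerSeries.coeff_mul]
    refine Finset.sum_nonneg fun ij _ => mul_nonneg (ih _) ?_
    rw [coeff_geomSeries]; positivity

lemma coeff_prod_geomSeries_le (N k : ℕ) :
    (∏ i ∈ Finset.range N, geomSeries i).coeff k ≤ partitionCount k := by
  refine Monotone.ge_of_tendsto (monotone_nat_of_le_succ fun N => ?_)
    (tendsto_coeff_prod_geomSeries k) N
  rw [Finset.prod_range_succ, PowerSeries.coeff_mul]
  have h := Finset.single_le_sum (s := antidiagonal k) (f := fun ij =>
    (∏ i ∈ Finset.range N, geomSeries i).coeff ij.1 * (geomSeries N).coeff ij.2)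
    (fun ij _ => mul_nonneg (coeff_prod_geomSeries_nonneg N _) (by
      rw [coeff_geomSeries]; positivity))
    (show (k, 0) ∈ antidiagonal k by simp)
  simpa [coeff_geomSeries] using h

lemma hasSum_geomSeries (i : ℕ) {x : ℝ} (h0 : 0 ≤ x) (h1 : x < 1) :
    HasSum (fun n => (geomSeries i).coeff n * x ^ n) (1 / (1 - x ^ (i + 1))) := by
  have hinj : Function.Injective fun j : ℕ => (i + 1) * j := fun a b h =>
    Nat.eq_of_mul_eq_mul_left (Nat.succ_pos i) h
  have hg := hasSum_geometric_of_lt_one (pow_nonneg h0 (i + 1))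
    (pow_lt_one₀ h0 h1 (Nat.succ_ne_zero i))
  rw [one_div, ← hinj.hasSum_iff]
  · convert hg using 2 with j
    rw [Function.comp_apply, coeff_geomSeries, if_pos (Dvd.intro _ rfl), one_mul, pow_mul]
  · intro n hn
    rw [coeff_geomSeries, if_neg, zero_mul]
    rintro ⟨c, rfl⟩
    exact hn ⟨c, rfl⟩

lemma hasSum_prod_geomSeries (N : ℕ) {x : ℝ} (h0 : 0 ≤ x) (h1 : x < 1) :
    HasSum (fun n => (∏ i ∈ Finset.range N, geomSeries i).coeff n * x ^ n)
      (∏ i ∈ Finset.range N, 1 / (1 - x ^ (i + 1))) := by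
  induction N with
  | zero =>
    simp only [Finset.range_zero, Finset.prod_empty, PowerSeries.coeff_one]
    convert hasSum_single (0 : ℕ) (f := fun n => (if n = 0 then (1 : ℝ) else 0) * x ^ n)
      (fun n hn => by simp [hn]) using 1
    simp
  | succ N ih =>
    have hg := hasSum_geomSeries N h0 h1
    have hs1 : Summable fun n => ‖(∏ i ∈ Finset.range N, geomSeries i).coeff n * x ^ n‖ :=
      ih.summable.norm
    have hs2 : Summable fun n => ‖(geomSeries N).coeff n * x ^ n‖ := hg.summable.norm
    have h2 := (summable_norm_sum_mul_antidiagonal_of_summable_norm hs1 hs2).of_norm.hasSum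
    rw [← tsum_mul_tsum_eq_tsum_sum_antidiagonal_of_summable_norm hs1 hs2, ih.tsum_eq,
      hg.tsum_eq, ← Finset.prod_range_succ] at h2
    have he : (fun n => (∏ i ∈ Finset.range (N + 1), geomSeries i).coeff n * x ^ n) = fun n =>
        ∑ ij ∈ antidiagonal n, (∏ i ∈ Finset.range N, geomSeries i).coeff ij.1 * x ^ ij.1 *
          ((geomSeries N).coeff ij.2 * x ^ ij.2) := by
      funext n
      rw [Finset.prod_range_succ, PowerSeries.coeff_mul, Finset.sum_mul]
      refine Finset.sum_congr rfl fun ij hij => ?_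
      rw [mem_antidiagonal] at hij
      rw [← hij, pow_add]
      ring
    rw [he]
    exact h2

section Product

variable {x : ℝ}

lemma one_sub_pow_pos (h0 : 0 ≤ x) (h1 : x < 1) (i : ℕ) : 0 < 1 - x ^ (i + 1) :=
  sub_pos.2 (pow_lt_one₀ h0 h1 (Nat.succ_ne_zero i))

lemma one_le_factor (h0 : 0 ≤ x) (h1 : x < 1) (i : ℕ) : 1 ≤ 1 / (1 - x ^ (i + 1)) := by
  rw [one_le_div (one_sub_pow_pos h0 h1 i)]
  have := pow_nonneg h0 (i + 1)
  linarith

lemma multipliable_factor (h0 : 0 ≤ x) (h1 : x < 1) :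
    Multipliable fun i : ℕ => 1 / (1 - x ^ (i + 1)) := by
  have h : (fun i : ℕ => 1 / (1 - x ^ (i + 1))) =
      fun i : ℕ => 1 + x ^ (i + 1) / (1 - x ^ (i + 1)) := by
    funext i
    have := (one_sub_pow_pos h0 h1 i).ne'
    field_simp
    ring
  rw [h]
  refine multipliable_one_add_of_summable ?_
  have hs : Summable fun i : ℕ => x ^ (i + 1) / (1 - x) :=
    ((summable_nat_add_iff 1).2 (summable_geometric_of_lt_one h0 h1)).div_const _
  refine hs.of_nonneg_of_le (fun i => norm_nonneg _) fun i => ?_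
  rw [Real.norm_of_nonneg (div_nonneg (pow_nonneg h0 _) (one_sub_pow_pos h0 h1 i).le)]
  refine div_le_div_of_nonneg_left (pow_nonneg h0 _) (by linarith) ?_
  have : x ^ (i + 1) ≤ x := pow_le_of_le_one h0 h1.le (Nat.succ_ne_zero i)
  linarith

lemma tendsto_prod_P (h0 : 0 ≤ x) (h1 : x < 1) :
    Tendsto (fun N => ∏ i ∈ Finset.range N, 1 / (1 - x ^ (i + 1))) atTop (𝓝 (P x)) :=
  (multipliable_factor h0 h1).hasProd.tendsto_prod_nat

lemma prod_le_P (h0 : 0 ≤ x) (h1 : x < 1) (N : ℕ) :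
    ∏ i ∈ Finset.range N, 1 / (1 - x ^ (i + 1)) ≤ P x := by
  refine Monotone.ge_of_tendsto (monotone_nat_of_le_succ fun N => ?_) (tendsto_prod_P h0 h1) N
  rw [Finset.prod_range_succ]
  refine le_mul_of_one_le_right (Finset.prod_nonneg fun i _ => ?_) (one_le_factor h0 h1 N)
  exact zero_le_one.trans (one_le_factor h0 h1 i)

/-- Euler's product for the generating function of the partition numbers. -/
theorem hasSum_partitionCount (h0 : 0 ≤ x) (h1 : x < 1) :
    HasSum (fun k => (partitionCount k : ℝ) * x ^ k) (P x) := by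
  have hnn : ∀ k, 0 ≤ (partitionCount k : ℝ) * x ^ k := fun k =>
    mul_nonneg (Nat.cast_nonneg _) (pow_nonneg h0 k)
  have hle : ∀ K, ∑ k ∈ Finset.range K, (partitionCount k : ℝ) * x ^ k ≤ P x := by
    intro K
    have hlim : Tendsto (fun N => ∑ k ∈ Finset.range K,
        (∏ i ∈ Finset.range N, geomSeries i).coeff k * x ^ k) atTop
        (𝓝 (∑ k ∈ Finset.range K, (partitionCount k : ℝ) * x ^ k)) :=
      tendsto_finsetSum _ fun k _ => (tendsto_coeff_prod_geomSeries k).mul_const _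
    refine le_of_tendsto hlim (Eventually.of_forall fun N => ?_)
    refine le_trans ?_ (prod_le_P h0 h1 N)
    exact sum_le_hasSum _ (fun k _ => mul_nonneg (coeff_prod_geomSeries_nonneg N k)
      (pow_nonneg h0 k)) (hasSum_prod_geomSeries N h0 h1)
  have hs : Summable fun k => (partitionCount k : ℝ) * x ^ k :=
    summable_of_sum_range_le hnn hle
  convert hs.hasSum using 1
  refine le_antisymm ?_ (Summable.tsum_le_of_sum_range_le hs hle)
  refine le_of_tendsto (tendsto_prod_P h0 h1) (Eventually.of_forall fun N => ?_)
  refine hasSum_le (fun k => ?_) (hasSum_prod_geomSeries N h0 h1) hs.hasSum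
  exact mul_le_mul_of_nonneg_right (coeff_prod_geomSeries_le N k) (pow_nonneg h0 k)

/-- An upper bound for `P` by a finite product, with the tail estimated by a geometric series. -/
lemma P_mul_le (h0 : 0 ≤ x) (h1 : x < 1) (N : ℕ) :
    P x * (1 - x ^ (N + 1) / (1 - x)) ≤ ∏ i ∈ Finset.range N, 1 / (1 - x ^ (i + 1)) := by
  have hx : 0 < 1 - x := by linarith
  have hprod : ∀ M, 1 - x ^ (N + 1) / (1 - x) ≤
      ∏ i ∈ Finset.range M, (1 - x ^ (N + i + 1)) := by
    -- Weierstrass's inequality `∏ (1 - aᵢ) ≥ 1 - ∑ aᵢ` for the terms after the `N`-th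
    have key : ∀ M, 1 - (x ^ (N + 1) - x ^ (N + M + 1)) / (1 - x) ≤
        ∏ i ∈ Finset.range M, (1 - x ^ (N + i + 1)) ∧
        ∏ i ∈ Finset.range M, (1 - x ^ (N + i + 1)) ≤ 1 := by
      intro M
      induction M with
      | zero => simp
      | succ M ih =>
        rw [Finset.prod_range_succ]
        have hy0 := pow_nonneg h0 (N + M + 1)
        have hy1 := (one_sub_pow_pos h0 h1 (N + M)).le
        constructor
        · have e : 1 - (x ^ (N + 1) - x ^ (N + (M + 1) + 1)) / (1 - x) =
              1 - (x ^ (N + 1) - x ^ (N + M + 1)) / (1 - x) - x ^ (N + M + 1) := by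
            field_simp
            ring
          rw [e]
          nlinarith [ih.1, ih.2]
        · exact mul_le_one₀ ih.2 hy1 (by linarith)
    intro M
    refine le_trans ?_ (key M).1
    have : 0 ≤ x ^ (N + M + 1) / (1 - x) := div_nonneg (pow_nonneg h0 _) hx.le
    rw [sub_div]
    linarith
  refine le_of_tendsto ((tendsto_prod_P h0 h1).mul_const _) ?_
  filter_upwards [eventually_ge_atTop N] with K hK
  obtain ⟨M, rfl⟩ := Nat.exists_eq_add_of_le hK
  rw [Finset.prod_range_add, mul_assoc]
  refine mul_le_of_le_one_right (Finset.prod_nonneg fun i _ =>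
    zero_le_one.trans (one_le_factor h0 h1 i)) ?_
  have hpos : 0 < ∏ i ∈ Finset.range M, (1 - x ^ (N + i + 1)) :=
    Finset.prod_pos fun i _ => one_sub_pow_pos h0 h1 (N + i)
  rw [Finset.prod_div_distrib, Finset.prod_const_one, one_div, inv_mul_le_iff₀ hpos, mul_one]
  exact hprod M

end Product

/-! ### The derivative of the partition generating function -/

/-- The chords of a power are bounded by its derivatives at the end points. -/
lemma mul_pow_mul_sub_le {a b : ℝ} (ha : 0 ≤ a) (hab : a ≤ b) (n : ℕ) :
    n * a ^ (n - 1) * (b - a) ≤ b ^ n - a ^ n ∧ b ^ n - a ^ n ≤ n * b ^ (n - 1) * (b - a) := by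
  have key : ∀ m : ℕ, (m + 1) * a ^ m * (b - a) ≤ b ^ (m + 1) - a ^ (m + 1) ∧
      b ^ (m + 1) - a ^ (m + 1) ≤ (m + 1) * b ^ m * (b - a) := by
    intro m
    induction m with
    | zero => simp
    | succ m ih =>
      have hb := ha.trans hab
      have hd : 0 ≤ b - a := sub_nonneg.2 hab
      have hm : (0 : ℝ) ≤ m + 1 := by positivity
      have hp : a ^ (m + 1) ≤ b ^ (m + 1) := pow_le_pow_left₀ ha hab _
      have h1 := mul_le_mul_of_nonneg_left ih.1 ha
      have h2 := mul_le_mul_of_nonneg_left ih.2 hb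
      have h3 := mul_nonneg hd (sub_nonneg.2 hp)
      push_cast
      constructor
      · have e : b ^ (m + 1 + 1) - a ^ (m + 1 + 1) =
            a * (b ^ (m + 1) - a ^ (m + 1)) + b ^ (m + 1) * (b - a) := by ring
        have e2 : ((m : ℝ) + 1 + 1) * a ^ (m + 1) * (b - a) =
            a * ((m + 1) * a ^ m * (b - a)) + a ^ (m + 1) * (b - a) := by ring
        rw [e, e2]
        linarith
      · have e : b ^ (m + 1 + 1) - a ^ (m + 1 + 1) =
            b * (b ^ (m + 1) - a ^ (m + 1)) + a ^ (m + 1) * (b - a) := by ring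
        have e2 : ((m : ℝ) + 1 + 1) * b ^ (m + 1) * (b - a) =
            b * ((m + 1) * b ^ m * (b - a)) + b ^ (m + 1) * (b - a) := by ring
        rw [e, e2]
        linarith
  cases n with
  | zero => simp
  | succ m => simpa using key m

section Derivative

variable {x : ℝ}

lemma summable_deriv_term (h0 : 0 ≤ x) (h1 : x < 1) :
    Summable fun k : ℕ => (partitionCount k : ℝ) * (k * x ^ (k - 1)) := by
  obtain ⟨c, hc, hc1⟩ := exists_between h1
  have hs := ((hasSum_partitionCount (h0.trans hc.le) hc1).summable).div_const (c - x)
  refine hs.of_nonneg_of_le (fun k => by positivity) fun k => ?_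
  have hd : 0 < c - x := sub_pos.2 hc
  rw [le_div_iff₀ hd, mul_assoc]
  refine mul_le_mul_of_nonneg_left ?_ (Nat.cast_nonneg _)
  have := (mul_pow_mul_sub_le h0 hc.le k).1
  have := pow_nonneg h0 k
  linarith

/-- The partition generating function may be differentiated term by term. -/
lemma hasDerivAt_P (h0 : 0 < x) (h1 : x < 1) :
    HasDerivAt P (∑' k : ℕ, (partitionCount k : ℝ) * (k * x ^ (k - 1))) x := by
  obtain ⟨b, hb, hb1⟩ := exists_between h1
  have h := hasDerivAt_tsum_of_isPreconnected (t := Set.Ioo 0 b)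
    (g := fun (k : ℕ) y => (partitionCount k : ℝ) * y ^ k)
    (g' := fun (k : ℕ) y => (partitionCount k : ℝ) * (k * y ^ (k - 1)))
    (summable_deriv_term (h0.trans hb).le hb1) isOpen_Ioo isPreconnected_Ioo
    (fun k y _ => (hasDerivAt_pow k y).const_mul _)
    (fun k y hy => by
      rw [Real.norm_of_nonneg (by have := hy.1; positivity)]
      have := pow_le_pow_left₀ hy.1.le hy.2.le (k - 1)
      gcongr)
    (y₀ := x) ⟨h0, hb⟩ (hasSum_partitionCount h0.le h1).summable ⟨h0, hb⟩
  refine h.congr_of_eventuallyEq ?_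
  filter_upwards [Ioo_mem_nhds h0 h1] with y hy
  exact (hasSum_partitionCount hy.1.le hy.2).tsum_eq.symm

lemma hasSum_deriv_P (h0 : 0 < x) (h1 : x < 1) :
    HasSum (fun k : ℕ => (partitionCount k : ℝ) * (k * x ^ (k - 1))) (deriv P x) := by
  rw [(hasDerivAt_P h0 h1).deriv]
  exact (summable_deriv_term h0.le h1).hasSum

/-- The chords of `P` are bounded by its derivatives at the end points. -/
lemma deriv_P_mul_sub_le {a b : ℝ} (ha : 0 < a) (hab : a ≤ b) (hb : b < 1) :
    deriv P a * (b - a) ≤ P b - P a ∧ P b - P a ≤ deriv P b * (b - a) := by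
  have hs := (hasSum_partitionCount (ha.le.trans hab) hb).sub
    (hasSum_partitionCount ha.le (hab.trans_lt hb))
  have h1 := (hasSum_deriv_P ha (hab.trans_lt hb)).mul_right (b - a)
  have h2 := (hasSum_deriv_P (ha.trans_le hab) hb).mul_right (b - a)
  constructor
  · refine hasSum_le (fun k => ?_) h1 hs
    rw [← mul_sub, mul_assoc]
    exact mul_le_mul_of_nonneg_left (mul_pow_mul_sub_le ha.le hab k).1 (Nat.cast_nonneg _)
  · refine hasSum_le (fun k => ?_) hs h2
    rw [← mul_sub, mul_assoc]
    exact mul_le_mul_of_nonneg_left (mul_pow_mul_sub_le ha.le hab k).2 (Nat.cast_nonneg _)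

lemma one_le_P (h0 : 0 ≤ x) (h1 : x < 1) : 1 ≤ P x := by
  simpa using prod_le_P h0 h1 0

lemma P_mono {a b : ℝ} (ha : 0 ≤ a) (hab : a ≤ b) (hb : b < 1) : P a ≤ P b :=
  hasSum_le (fun k => mul_le_mul_of_nonneg_left (pow_le_pow_left₀ ha hab k) (Nat.cast_nonneg _))
    (hasSum_partitionCount ha (hab.trans_lt hb)) (hasSum_partitionCount (ha.trans hab) hb)

lemma mul_P_lt {a b : ℝ} (ha : 0 ≤ a) (hab : a < b) (hb : b < 1) : a * P a < b * P b := by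
  have h1 := P_mono ha hab.le hb
  have h2 := one_le_P ha (hab.trans hb)
  nlinarith

/-- The mean of the distribution that gives the gap `k + 1` the weight `p(k) x ^ (k + 1)`. -/
lemma hasSum_mean (h0 : 0 < x) (h1 : x < 1) :
    HasSum (fun k : ℕ => ((k : ℝ) + 1) * ((partitionCount k : ℝ) * x ^ (k + 1)))
      (x * (P x + x * deriv P x)) := by
  have h := ((hasSum_partitionCount h0.le h1).add
    ((hasSum_deriv_P h0 h1).mul_left x)).mul_left x
  have he : (fun k : ℕ => ((k : ℝ) + 1) * ((partitionCount k : ℝ) * x ^ (k + 1))) = fun k : ℕ =>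
      x * ((partitionCount k : ℝ) * x ^ k + x * ((partitionCount k : ℝ) * (k * x ^ (k - 1)))) := by
    funext k
    cases k with
    | zero => simp; ring
    | succ k => simp only [Nat.add_sub_cancel]; push_cast; ring
  rw [he]
  exact h

end Derivative

/-! ### The numerical values -/

lemma le_P_of_prod_le {x c : ℝ} (h0 : 0 ≤ x) (h1 : x < 1) (N : ℕ)
    (h : c * ∏ i ∈ Finset.range N, (1 - x ^ (i + 1)) ≤ 1) : c ≤ P x := by
  refine le_trans ?_ (prod_le_P h0 h1 N)
  have hpos : 0 < ∏ i ∈ Finset.range N, (1 - x ^ (i + 1)) :=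
    Finset.prod_pos fun i _ => one_sub_pow_pos h0 h1 i
  rw [Finset.prod_div_distrib, Finset.prod_const_one, le_div_iff₀ hpos]
  exact h

lemma P_le_of_le_prod {x c : ℝ} (h0 : 0 ≤ x) (h1 : x < 1) (N : ℕ)
    (ht : 0 < 1 - x ^ (N + 1) / (1 - x))
    (h : 1 ≤ c * (1 - x ^ (N + 1) / (1 - x)) * ∏ i ∈ Finset.range N, (1 - x ^ (i + 1))) :
    P x ≤ c := by
  have hpos : 0 < ∏ i ∈ Finset.range N, (1 - x ^ (i + 1)) :=
    Finset.prod_pos fun i _ => one_sub_pow_pos h0 h1 i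
  refine le_of_mul_le_mul_right ((P_mul_le h0 h1 N).trans ?_) ht
  rw [Finset.prod_div_distrib, Finset.prod_const_one, div_le_iff₀ hpos]
  exact h

/-- The points lie `10 ^ (-5)` apart, so that the chord between them gives `P'` to within about
`10 ^ (-3)`; with `26` factors the truncation error is below `10 ^ (-9)`. -/
lemma P_bounds_left : P 0.41959 ≤ 2.383123278 ∧ 2.383216815 ≤ P 0.4196 ∧
    P 0.4196 ≤ 2.383216816 := by
  refine ⟨P_le_of_le_prod (by norm_num) (by norm_num) 26 ?_ ?_,
    le_P_of_prod_le (by norm_num) (by norm_num) 26 ?_,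
    P_le_of_le_prod (by norm_num) (by norm_num) 26 ?_ ?_⟩ <;>
  norm_num [Finset.prod_range_succ]

/-- The counterpart to the right of the root. -/
lemma P_bounds_right : 2.383226169 ≤ P 0.419601 ∧ P 0.419611 ≤ 2.383319716 := by
  refine ⟨le_P_of_prod_le (by norm_num) (by norm_num) 26 ?_,
    P_le_of_le_prod (by norm_num) (by norm_num) 26 ?_ ?_⟩ <;>
  norm_num [Finset.prod_range_succ]

lemma deriv_P_mono {a b : ℝ} (ha : 0 < a) (hab : a ≤ b) (hb : b < 1) :
    deriv P a ≤ deriv P b :=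
  hasSum_le (fun k => by have := pow_le_pow_left₀ ha.le hab (k - 1); gcongr)
    (hasSum_deriv_P ha (hab.trans_lt hb)) (hasSum_deriv_P (ha.trans_le hab) hb)

/-- The root of `x P(x) = 1`. -/
lemma exists_root : ∃ x₀ : ℝ, 0.4196 < x₀ ∧ x₀ < 0.419601 ∧ x₀ * P x₀ = 1 := by
  have hcont : ContinuousOn (fun x => x * P x) (Set.Icc 0.4196 0.419601) := by
    intro x hx
    have h := (hasDerivAt_P (x := x) (lt_of_lt_of_le (by norm_num) hx.1)
      (lt_of_le_of_lt hx.2 (by norm_num))).continuousAt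
    exact (continuousAt_id.mul h).continuousWithinAt
  have h1 : (0.4196 : ℝ) * P 0.4196 < 1 := by have := P_bounds_left.2.2; linarith
  have h2 : 1 < (0.419601 : ℝ) * P 0.419601 := by have := P_bounds_right.1; linarith
  obtain ⟨x, hx, hx1⟩ := intermediate_value_Ioo (by norm_num) hcont ⟨h1, h2⟩
  exact ⟨x, hx.1, hx.2, hx1⟩

lemma root_unique {x y : ℝ} (hx : x ∈ Set.Ioo (0 : ℝ) 1) (hy : y ∈ Set.Ioo (0 : ℝ) 1)
    (hx1 : x * P x = 1) (hy1 : y * P y = 1) : x = y := by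
  rcases lt_trichotomy x y with h | h | h
  · have := mul_P_lt hx.1.le h hy.2; linarith
  · exact h
  · have := mul_P_lt hy.1.le h hx.2; linarith

/-- `P'` is increasing, and is bounded below by the chord to the left of the root and above by the
chord to its right. -/
lemma deriv_P_bounds {x : ℝ} (h1 : 0.4196 < x) (h2 : x < 0.419601) :
    9.353 ≤ deriv P x ∧ deriv P x ≤ 9.355 := by
  obtain ⟨b1, b2, -⟩ := P_bounds_left
  obtain ⟨b3, b4⟩ := P_bounds_right
  have d1 := (deriv_P_mul_sub_le (a := 0.41959) (b := 0.4196) (by norm_num) (by norm_num)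
    (by norm_num)).2
  have d2 := (deriv_P_mul_sub_le (a := 0.419601) (b := 0.419611) (by norm_num) (by norm_num)
    (by norm_num)).1
  have m1 := deriv_P_mono (a := 0.4196) (b := x) (by norm_num) h1.le (by linarith)
  have m2 := deriv_P_mono (a := x) (b := 0.419601) (by linarith) h2.le (by norm_num)
  norm_num at d1 d2
  constructor <;> linarith

lemma leadingConstant_bound {x : ℝ} (h1 : 0.4196 < x) (h2 : x < 0.419601) (hx : x * P x = 1) :
    |leadingConstant x - 0.01450| ≤ 0.000005 := by
  have hx0 : 0 < x := by linarith
  have hx1 : 0 < 1 - x := by linarith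
  obtain ⟨d1, d2⟩ := deriv_P_bounds h1 h2
  have hP1 : 2.38321 ≤ P x := by nlinarith
  have hP2 : P x ≤ 2.383223 := by nlinarith
  have hw1 : 1.72294 ≤ 1 / (1 - x) := by rw [le_div_iff₀ hx1]; linarith
  have hw2 : 1 / (1 - x) ≤ 1.722955 := by rw [div_le_iff₀ hx1]; linarith
  have hq1 : 0.660255 ≤ P x - 1 / (1 - x) := by linarith
  have hq2 : P x - 1 / (1 - x) ≤ 0.660283 := by linarith
  have hs1 : 0.660255 ^ 2 ≤ (P x - 1 / (1 - x)) ^ 2 := pow_le_pow_left₀ (by norm_num) hq1 2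
  have hs2 : (P x - 1 / (1 - x)) ^ 2 ≤ 0.660283 ^ 2 :=
    pow_le_pow_left₀ (by linarith) hq2 2
  have hm1 : 0.4196 * 9.353 ≤ x * deriv P x :=
    mul_le_mul h1.le d1 (by norm_num) hx0.le
  have hm2 : x * deriv P x ≤ 0.419601 * 9.355 :=
    mul_le_mul h2.le d2 (by linarith) (by norm_num)
  have hden : 0 < P x + x * deriv P x := by linarith
  have hr1 : 0.066510 ≤ x / (P x + x * deriv P x) := by rw [le_div_iff₀ hden]; linarith
  have hr2 : x / (P x + x * deriv P x) ≤ 0.066525 := by rw [div_le_iff₀ hden]; linarith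
  have hl := mul_le_mul hs1 hr1 (by norm_num) (sq_nonneg _)
  have hu := mul_le_mul hs2 hr2 (by linarith) (by norm_num)
  unfold leadingConstant
  rw [abs_le]
  norm_num at hl hu ⊢
  constructor <;> linarith

lemma inv_root_bound {x : ℝ} (h1 : 0.4196 < x) (h2 : x < 0.419601) :
    |1 / x - 2.3832| ≤ 0.00005 := by
  have hx0 : 0 < x := by linarith
  have h3 : 2.38321 ≤ 1 / x := by rw [le_div_iff₀ hx0]; linarith
  have h4 : 1 / x ≤ 2.38323 := by rw [div_le_iff₀ hx0]; linarith
  rw [abs_le]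
  constructor <;> linarith

/-! ### Asymptotics -/

lemma partitionCount_zero_pos : 0 < partitionCount 0 :=
  have : Nonempty (Nat.Partition 0) := ⟨Nat.Partition.indiscrete 0⟩
  Nat.card_pos

/-- Multiplication by `x ^ n` turns convolutions of counting sequences into convolutions. -/
lemma sum_antidiagonal_mul_pow (a b : ℕ → ℕ) (x : ℝ) (n : ℕ) :
    ((∑ ij ∈ antidiagonal n, a ij.1 * b ij.2 : ℕ) : ℝ) * x ^ n =
      ∑ ij ∈ antidiagonal n, (a ij.1 * x ^ ij.1) * (b ij.2 * x ^ ij.2) := by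
  push_cast
  rw [Finset.sum_mul]
  refine Finset.sum_congr rfl fun ij hij => ?_
  rw [mem_antidiagonal] at hij
  rw [← hij, pow_add]
  ring

section Root

variable {x : ℝ}

lemma hasSum_gap (h0 : 0 < x) (h1 : x < 1) (hx : x * P x = 1) :
    HasSum (fun k => (partitionCount k : ℝ) * x ^ (k + 1)) 1 := by
  have h := (hasSum_partitionCount h0.le h1).mul_left x
  rw [hx] at h
  have he : (fun k => (partitionCount k : ℝ) * x ^ (k + 1)) =
      fun k => x * ((partitionCount k : ℝ) * x ^ k) := by
    funext k; ring
  rwa [he]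

lemma listCount_mul_pow_zero : (listCount 0 : ℝ) * x ^ 0 = 1 := by
  rw [listCount_zero]; simp

lemma listCount_mul_pow_succ (n : ℕ) : (listCount (n + 1) : ℝ) * x ^ (n + 1) =
    ∑ ij ∈ antidiagonal n, ((partitionCount ij.1 : ℝ) * x ^ (ij.1 + 1)) *
      ((listCount ij.2 : ℝ) * x ^ ij.2) := by
  rw [listCount_succ, pow_succ, ← mul_assoc, sum_antidiagonal_mul_pow, Finset.sum_mul]
  refine Finset.sum_congr rfl fun ij _ => ?_
  ring

lemma listCount_mul_pow_le_one (h0 : 0 < x) (h1 : x < 1) (hx : x * P x = 1) (n : ℕ) :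
    (listCount n : ℝ) * x ^ n ≤ 1 :=
  (renewal_mem_Icc (f := fun k => (partitionCount k : ℝ) * x ^ (k + 1))
    (v := fun n => (listCount n : ℝ) * x ^ n) (fun k => by positivity) (hasSum_gap h0 h1 hx)
    listCount_mul_pow_zero listCount_mul_pow_succ n).2

lemma tendsto_listCount (h0 : 0 < x) (h1 : x < 1) (hx : x * P x = 1) :
    Tendsto (fun n => (listCount n : ℝ) * x ^ n) atTop
      (𝓝 (x * (P x + x * deriv P x))⁻¹) := by
  have := partitionCount_zero_pos
  exact renewal_theorem (f := fun k => (partitionCount k : ℝ) * x ^ (k + 1))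
    (fun k => by positivity) (hasSum_gap h0 h1 hx) (by positivity) (hasSum_mean h0 h1)
    listCount_mul_pow_zero listCount_mul_pow_succ

/-- Of the partitions of `k` exactly one has fewer than two parts, whence the term `1 / (1 - x)`. -/
lemma hasSum_endCount (h0 : 0 < x) (h1 : x < 1) :
    HasSum (fun n => (endCount n : ℝ) * x ^ n) (x * (P x - 1 / (1 - x))) := by
  have h := ((hasSum_partitionCount h0.le h1).sub
    (hasSum_geometric_of_lt_one h0.le h1)).mul_left x
  have he : (fun k => x * ((partitionCount k : ℝ) * x ^ k - x ^ k)) =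
      fun k => (endCount (k + 1) : ℝ) * x ^ (k + 1) := by
    funext k
    rw [← card_endLegs_succ]
    push_cast [endCount]
    ring
  rw [he] at h
  have h2 := (hasSum_nat_add_iff (f := fun n => (endCount n : ℝ) * x ^ n) 1).1 h
  simpa [endCount, card_endLegs_zero] using h2

lemma tendsto_longCount (h0 : 0 < x) (h1 : x < 1) (hx : x * P x = 1) :
    Tendsto (fun n => (longCount n : ℝ) * x ^ n) atTop (𝓝 (x * (P x - 1 / (1 - x)) *
      (x * (P x - 1 / (1 - x)) * (x * (P x + x * deriv P x))⁻¹))) := by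
  have hc := hasSum_endCount h0 h1
  have hc0 : ∀ n, 0 ≤ (endCount n : ℝ) * x ^ n := fun n => by positivity
  have h2 := tendsto_convolution hc0 hc (tendsto_convolution hc0 hc (tendsto_listCount h0 h1 hx))
  refine h2.congr fun n => ?_
  rw [longCount_eq,
    sum_antidiagonal_mul_pow endCount fun m =>
      ∑ kl ∈ antidiagonal m, listCount kl.1 * endCount kl.2]
  refine Finset.sum_congr rfl fun ij _ => ?_
  rw [sum_antidiagonal_mul_pow, ← Finset.Nat.sum_antidiagonal_swap]
  congr 1
  refine Finset.sum_congr rfl fun kl _ => ?_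
  simp only [Prod.fst_swap, Prod.snd_swap]
  ring

lemma tendsto_card_legs (h0 : 0 < x) (h1 : x < 1) :
    Tendsto (fun n => (Nat.card {π : Legs // π.weight = n} : ℝ) * x ^ n) atTop (𝓝 0) := by
  rw [← tendsto_add_atTop_iff_nat 1]
  simp only [card_legs_succ]
  have h := (hasSum_partitionCount h0.le h1).summable.tendsto_atTop_zero.mul_const x
  rw [zero_mul] at h
  refine h.congr fun n => ?_
  ring

/-- Palindromes are negligible: their number is `O(n x ^ (-n / 2))`, as a palindrome
is determined by a first half, of weight at most `n / 2`, and a middle entry. -/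
lemma tendsto_palindromeCount (h0 : 0 < x) (h1 : x < 1) (hx : x * P x = 1) :
    Tendsto (fun n => (palindromeCount n : ℝ) * x ^ n) atTop (𝓝 0) := by
  obtain ⟨y, hy0, hy1, rfl⟩ : ∃ y : ℝ, 0 < y ∧ y < 1 ∧ x = y ^ 2 :=
    ⟨√x, Real.sqrt_pos.2 h0, by rw [Real.sqrt_lt' one_pos]; simpa using h1,
      (Real.sq_sqrt h0.le).symm⟩
  obtain ⟨K, hK⟩ := ((tendsto_card_legs hy0 hy1).add
    (tendsto_pow_atTop_nhds_zero_of_lt_one hy0.le hy1)).bddAbove_range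
  have hK' : ∀ j, ((Nat.card {π : Legs // π.weight = j} + 1 : ℕ) : ℝ) * y ^ j ≤ K := fun j => by
    refine le_trans (le_of_eq ?_) (hK ⟨j, rfl⟩)
    push_cast; ring
  have hK0 : 0 ≤ K := le_trans (by positivity) (hK' 0)
  have hA : ∀ i, (Nat.card {l : List Legs // 2 * weight l = i} : ℝ) * y ^ i ≤ 1 := by
    intro i
    rcases Nat.even_or_odd' i with ⟨m, rfl | rfl⟩
    · have e : Nat.card {l : List Legs // 2 * weight l = 2 * m} = listCount m :=
        Nat.card_congr (Equiv.subtypeEquivRight fun l => by omega)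
      rw [e, pow_mul]
      exact listCount_mul_pow_le_one h0 h1 hx m
    · have : IsEmpty {l : List Legs // 2 * weight l = 2 * m + 1} :=
        ⟨fun l => by have := l.2; omega⟩
      simp
  have hbound : ∀ n, (palindromeCount n : ℝ) * y ^ n ≤ (n + 1) * K := by
    intro n
    have h2 : (palindromeCount n : ℝ) ≤ _ := Nat.cast_le.2 (palindromeCount_le n)
    refine (mul_le_mul_of_nonneg_right h2 (by positivity)).trans ?_
    rw [sum_antidiagonal_mul_pow (fun i => Nat.card {l : List Legs // 2 * weight l = i})
      fun j => Nat.card {π : Legs // π.weight = j} + 1]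
    refine (Finset.sum_le_card_nsmul _ _ K fun ij _ => ?_).trans_eq ?_
    · exact (mul_le_of_le_one_left (by positivity) (hA ij.1)).trans (hK' ij.2)
    · rw [Finset.Nat.card_antidiagonal, nsmul_eq_mul]; push_cast; ring
  have hlim : Tendsto (fun n : ℕ => ((n : ℝ) * y ^ n + y ^ n) * K) atTop (𝓝 0) := by
    have := ((tendsto_self_mul_const_pow_of_lt_one hy0.le hy1).add
      (tendsto_pow_atTop_nhds_zero_of_lt_one hy0.le hy1)).mul_const K
    simpa using this
  refine squeeze_zero (fun n => by positivity) (fun n => ?_) hlim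
  calc (palindromeCount n : ℝ) * (y ^ 2) ^ n = (palindromeCount n * y ^ n) * y ^ n := by
        rw [← pow_mul, mul_comm 2 n, pow_mul]; ring
    _ ≤ ((n + 1) * K) * y ^ n := mul_le_mul_of_nonneg_right (hbound n) (by positivity)
    _ = _ := by ring

/-- The number of codes dominates in `2 aₙ`. -/
lemma tendsto_linearTreeCount (h0 : 0 < x) (h1 : x < 1) (hx : x * P x = 1) :
    Tendsto (fun n => (linearTreeCount n : ℝ) * x ^ n) atTop (𝓝 (leadingConstant x)) := by
  set c := x * (P x - 1 / (1 - x)) *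
    (x * (P x - 1 / (1 - x)) * (x * (P x + x * deriv P x))⁻¹) with hc
  have hl := tendsto_longCount h0 h1 hx
  have hu := (hl.add (tendsto_palindromeCount h0 h1 hx)).add
    ((tendsto_card_legs h0 h1).const_mul 2)
  rw [mul_zero, add_zero, add_zero] at hu
  have h2 : Tendsto (fun n => 2 * ((linearTreeCount n : ℝ) * x ^ n)) atTop (𝓝 c) := by
    refine tendsto_of_tendsto_of_tendsto_of_le_of_le hl hu (fun n => ?_) (fun n => ?_)
    · have h3 : (longCount n : ℝ) ≤ 2 * linearTreeCount n := by
        exact_mod_cast (two_mul_linearTreeCount_bounds n).1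
      have := mul_le_mul_of_nonneg_right h3 (pow_nonneg h0.le n)
      simp only; linarith
    · have h3 : 2 * (linearTreeCount n : ℝ) ≤ longCount n + palindromeCount n +
          2 * Nat.card {π : Legs // π.weight = n} := by
        exact_mod_cast (two_mul_linearTreeCount_bounds n).2
      have := mul_le_mul_of_nonneg_right h3 (pow_nonneg h0.le n)
      simp only; linarith
  have h3 := h2.const_mul (1 / 2)
  have hcL : 1 / 2 * c = leadingConstant x := by
    rw [hc, leadingConstant, mul_inv]
    field_simp
  rw [hcL] at h3
  refine h3.congr fun n => ?_
  ring

/-- Linear trees form a vanishing proportion of all trees, since `24! / x ^ 24 < 24 ^ 24`. -/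
lemma tendsto_ratio (h0 : 0.4196 < x) (h1 : x < 1) {L : ℝ}
    (h : Tendsto (fun n => (linearTreeCount n : ℝ) * x ^ n) atTop (𝓝 L)) :
    Tendsto (fun n => (linearTreeCount n : ℝ) / treeCount n) atTop (𝓝 0) := by
  have hx0 : 0 < x := by linarith
  obtain ⟨K, hK⟩ := h.bddAbove_range
  have hK' : ∀ n, (linearTreeCount n : ℝ) * x ^ n ≤ K := fun n => hK ⟨n, rfl⟩
  have hK0 : 0 ≤ K := le_trans (by positivity) (hK' 0)
  set F : ℝ := ((Nat.factorial 24 : ℕ) : ℝ) with hF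
  have hF0 : 0 < F := by rw [hF]; positivity
  set q : ℝ := F / (24 * x) ^ 24 with hq
  have hq0 : 0 < q := by positivity
  have hq1 : q < 1 := by
    rw [hq, div_lt_one (by positivity)]
    have : (24 * 0.4196 : ℝ) ^ 24 < (24 * x) ^ 24 :=
      pow_lt_pow_left₀ (by linarith) (by norm_num) (by norm_num)
    refine lt_trans ?_ this
    rw [hF]
    norm_num [Nat.factorial]
  have hlim : Tendsto (fun m : ℕ => K * F * 24 / x ^ 48 * ((m : ℝ) * q ^ m + 2 * q ^ m)) atTop
      (𝓝 0) := by
    have := ((tendsto_self_mul_const_pow_of_lt_one hq0.le hq1).add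
      ((tendsto_pow_atTop_nhds_zero_of_lt_one hq0.le hq1).const_mul 2)).const_mul
        (K * F * 24 / x ^ 48)
    simpa using this
  have hh : Tendsto (fun n : ℕ => (n - 25) / 24) atTop atTop :=
    (Nat.tendsto_div_const_atTop (by norm_num)).comp (tendsto_sub_atTop_nat 25)
  refine squeeze_zero' (Eventually.of_forall fun n => by positivity) ?_ (hlim.comp hh)
  filter_upwards [eventually_ge_atTop 25] with n hn
  simp only [Function.comp_apply]
  -- level trees on `n` vertices with levels of size `24`, after a path that takes up the remainder
  set m := (n - 25) / 24 with hm
  obtain ⟨r, hr, hnr⟩ : ∃ r, r < 24 ∧ n = r + 1 + (m + 1) * 24 :=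
    ⟨(n - 25) % 24, Nat.mod_lt _ (by norm_num), by omega⟩
  have ht := pow_le_treeCount r m 24
  rw [← hnr] at ht
  have ht' : (24 : ℝ) ^ (m * 24) ≤ F ^ (m + 1) * (treeCount n * n) := by
    rw [hF]; exact_mod_cast ht
  have hT : 0 < (treeCount n : ℝ) := by
    rcases Nat.eq_zero_or_pos (treeCount n) with h3 | h3
    · rw [h3] at ht'
      simp only [Nat.cast_zero, zero_mul, mul_zero] at ht'
      exact absurd ht' (not_le.2 (by positivity))
    · exact_mod_cast h3
  rw [div_le_iff₀ hT]
  have hxn : x ^ (24 * m) * x ^ 48 ≤ x ^ n := by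
    rw [← pow_add]
    exact pow_le_pow_of_le_one hx0.le h1.le (by omega)
  have hnm : (n : ℝ) ≤ 24 * (m + 2) := by
    have : n ≤ 24 * (m + 2) := by omega
    exact_mod_cast this
  have ha : (linearTreeCount n : ℝ) * (x ^ (24 * m) * x ^ 48) ≤ K :=
    (mul_le_mul_of_nonneg_left hxn (Nat.cast_nonneg _)).trans (hK' n)
  have hqm : q ^ m = F ^ m / (24 ^ (m * 24) * x ^ (24 * m)) := by
    rw [hq, div_pow, ← pow_mul, mul_pow, mul_comm m 24]
  have hrhs : K * F * 24 / x ^ 48 * ((m : ℝ) * q ^ m + 2 * q ^ m) * treeCount n =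
      K * (F ^ (m + 1) * (treeCount n * (24 * (m + 2)))) /
        (24 ^ (m * 24) * (x ^ (24 * m) * x ^ 48)) := by
    rw [hqm]
    field_simp
    ring
  rw [hrhs, le_div_iff₀ (by positivity)]
  calc (linearTreeCount n : ℝ) * (24 ^ (m * 24) * (x ^ (24 * m) * x ^ 48))
      = (linearTreeCount n * (x ^ (24 * m) * x ^ 48)) * 24 ^ (m * 24) := by ring
    _ ≤ K * (F ^ (m + 1) * (treeCount n * (24 * (m + 2)))) := by
        refine mul_le_mul ha (ht'.trans ?_) (by positivity) hK0
        gcongr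

end Root

end LinearTrees

theorem theorem2 :
    -- the infinite product defining `P` converges on `(0, 1)`, to a differentiable function
    (∀ x ∈ Set.Ioo (0 : ℝ) 1,
      Multipliable (fun i : ℕ => 1 / (1 - x ^ (i + 1))) ∧ DifferentiableAt ℝ LinearTrees.P x) ∧
    ∃ x₀ : ℝ,
      -- `x₀` is the unique root of `x P(x) = 1` in `(0, 1)`, and `x₀ = 0.4196…`
      (∀ x : ℝ, (x ∈ Set.Ioo (0 : ℝ) 1 ∧ x * LinearTrees.P x = 1) ↔ x = x₀) ∧
      (0.4196 ≤ x₀ ∧ x₀ < 0.4197) ∧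
      -- the asymptotic formula
      (fun n : ℕ => (LinearTrees.linearTreeCount n : ℝ)) ~[atTop]
        (fun n : ℕ => LinearTrees.leadingConstant x₀ * (1 / x₀) ^ n) ∧
      -- the numerical values, correct to four significant digits and to four decimals
      |LinearTrees.leadingConstant x₀ - 0.01450| ≤ 0.000005 ∧
      |1 / x₀ - 2.3832| ≤ 0.00005 ∧
      -- linear trees form a vanishing proportion of all trees
      Tendsto
        (fun n : ℕ => (LinearTrees.linearTreeCount n : ℝ) / (LinearTrees.treeCount n : ℝ))
        atTop (𝓝 0) := by
  refine ⟨fun x hx => ⟨LinearTrees.multipliable_factor hx.1.le hx.2,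
    (LinearTrees.hasDerivAt_P hx.1 hx.2).differentiableAt⟩, ?_⟩
  obtain ⟨x₀, h1, h2, hx⟩ := LinearTrees.exists_root
  have h0 : 0 < x₀ := by linarith
  have h3 : x₀ < 1 := by linarith
  have hlim := LinearTrees.tendsto_linearTreeCount h0 h3 hx
  have hC := LinearTrees.leadingConstant_bound h1 h2 hx
  have hC0 : LinearTrees.leadingConstant x₀ ≠ 0 := by
    rw [abs_le] at hC
    intro h
    rw [h] at hC
    norm_num at hC
  refine ⟨x₀, fun x => ⟨fun h => LinearTrees.root_unique h.1 ⟨h0, h3⟩ h.2 hx, ?_⟩,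
    ⟨h1.le, by linarith⟩, ?_, hC, LinearTrees.inv_root_bound h1 h2,
    LinearTrees.tendsto_ratio h1 h3 hlim⟩
  · rintro rfl
    exact ⟨⟨h0, h3⟩, hx⟩
  · rw [isEquivalent_iff_tendsto_one (Eventually.of_forall fun n => by positivity)]
    have h4 := hlim.div_const (LinearTrees.leadingConstant x₀)
    rw [div_self hC0] at h4
    refine h4.congr fun n => ?_
    simp only [Pi.div_apply]
    rw [one_div, inv_pow]
    field_simp
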